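/- **Setting.** Let $\mathbb K\in\{\mathbb R,\mathbb C\}$, and let $\Gamma$ be a finite directed graph with vertex set $V$, edge set $E$, and starting and end vertices $\mathrm{vtx}_0(e),\mathrm{vtx}_1(e)\in V$ for $e\in E$ (loops and multiple edges allowed). To each $e\in E$ there belong an interval $[a_e,b_e]$, $a_e<b_e$, and a finite Borel measure $\mu_e$ on $[a_e,b_e]$ such that either $\mu_e=0$ or else $a_e,b_e\in\operatorname{spt}\mu_e$ and $\mu_e(\{a_e,b_e\})=0$; to each $v\in V$ there belongs a weight $\mu_v\ge 0$. Put $E_1=\{e:\mu_e\neq0\}$, $V_1=\{v:\mu_v>0\}$, $V_0=V\setminus V_1$, $E_1'=E_1\times\{0,1\}$, and $$\mathcal H_\Gamma=\bigoplus_{e\in E_1}L_2([a_e,b_e],\mu_e)\oplus\mathbb K^{V_1},$$ where $\mathbb K^{V_1}$ carries the scalar product $\sum_{v\in V_1} f_v\overline{g_v}\,\mu_v$. The space $\mathbb K^{E_1'\cup V_1}$ carries the scalar product $\sum_{(e,j)\in E_1'}\xi(e,j)\overline{\eta(e,j)}+\sum_{v\in V_1}\xi(v)\overline{\eta(v)}\mu_v$;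 for $v\in V$ let $I_v=\{(e,j)\in E_1':\mathrm{vtx}_j(e)=v\}$ if $v\in V_0$, and let $I_v$ be this set together with the element $v$ if $v\in V_1$; the space $\mathbb K^{I_v}$ carries the restricted scalar product. All scalar products $\langle\cdot,\cdot\rangle$ are linear in the first argument. Let $W^1_{2,\mu_e}(a_e,b_e)$ be the set of all $g\in W^1_2(a_e,b_e)\cap C[a_e,b_e]$ that are affine linear on the components of $[a_e,b_e]\setminus\operatorname{spt}\mu_e$. Let $D(\iota_e)$ be the set of all $f\in L_2([a_e,b_e],\mu_e)$ for which there is $g\in W^1_2(a_e,b_e)\cap C[a_e,b_e]$ with $g=f$ $\mu_e$-a.e., and let $\iota_ef$ be the unique such $g$ in $W^1_{2,\mu_e}(a_e,b_e)$. For $f\in\mathcal H_\Gamma$ with $f_e\in D(\iota_e)$ for all $e\in E_1$ (we write $f\in D(\iota)$), define $\operatorname{trace}(\iota f)\in\mathbb K^{E_1'\cup V_1}$ by the values $(\iota_ef_e)(a_e)$ at $(e,0)$, $(\iota_ef_e)(b_e)$ at $(e,1)$, and $f_v$ at $v\in V_1$. If $u\in L_{1,\mathrm{loc}}(a_e,b_e)$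 and $g\in L_1([a_e,b_e],\mu_e)$ satisfy $u'=g\mu_e$ in the sense of distributions on $(a_e,b_e)$, write $\partial_{\mu_e}u=g$; such $u$ has representatives of bounded variation. Let $D(\hat H)$ be the set of all $(f_e)_{e\in E_1}$ with $f_e\in D(\iota_e)$ such that $(\iota_ef_e)'\in L_1(a_e,b_e)$, and $\partial_{\mu_e}(\iota_ef_e)'$ exists and belongs to $L_2([a_e,b_e],\mu_e)$, for all $e\in E_1$, and let $\hat H(f_e)_e=(-\partial_{\mu_e}(\iota_ef_e)')_e$. For such $f$ let $\operatorname{strace}(\iota f)'\in\mathbb K^{E_1'\cup V_1}$ have the value $(\iota_ef_e)'(a_e+)$ at $(e,0)$, $-(\iota_ef_e)'(b_e-)$ at $(e,1)$ (one-sided limits of representatives of bounded variation), and $0$ at $v\in V_1$. Denote by $\operatorname{trace}_v(\iota f)$ and $\operatorname{strace}_v(\iota f)'$ the restrictions to $I_v$. Let $X$ be a subspace of $\mathbb K^{E_1'\cup V_1}$ and $L$ a self-adjoint operator in $X$. Define the form $\tau$ by $D(\tau)=\{f\in D(\iota):\operatorname{trace}(\iota f)\in X\}$ and $$\tau(f,g)=\sum_{e\in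 E_1}\int_{a_e}^{b_e}(\iota_ef_e)'(x)\overline{(\iota_eg_e)'(x)}\,dx+\langle L\operatorname{trace}(\iota f),\operatorname{trace}(\iota g)\rangle .$$ Assume that the restriction map $\xi\mapsto\xi|_{V_1}$ maps $X$ onto $\mathbb K^{V_1}$. Assume further that the boundary conditions are local: for each $v\in V$ there are a subspace $X_v\subseteq\mathbb K^{I_v}$ and a self-adjoint operator $L_v$ in $X_v$ such that $X=\bigoplus_{v\in V}X_v$ and $L=\bigoplus_{v\in V}L_v$. Let $X_{v,0}=X_v$ if $v\in V_0$, $X_{v,0}=\{\xi\in X_v:\xi(v)=0\}$ if $v\in V_1$, and let $Q_{v,0}$ be the orthogonal projection of $\mathbb K^{I_v}$ onto $X_{v,0}$. **Corollary 5.1.** There is a linear operator $H$ in $\mathcal H_\Gamma$ associated with $\tau$, i.e. such that $f\in D(H)$, $Hf=h$ if and only if $f\in D(\tau)$ and $\tau(f,g)=\langle h,g\rangle_{\mathcal H_\Gamma}$ for all $g\in D(\tau)$. It is given by $$D(H)=\Big\{f\in\mathcal H_\Gamma:\ (f_e)_{e\in E_1}\in D(\hat H),\ \operatorname{trace}_v(\iota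 f)\in X_v,\ Q_{v,0}\operatorname{strace}_v(\iota f)'=Q_{v,0}L_v\operatorname{trace}_v(\iota f)\ \ (v\in V)\Big\},$$ $$\big((Hf)_e\big)_{e\in E_1}=\hat H(f_e)_{e\in E_1},\qquad (Hf)_v=\frac1{\mu_v}\big\langle L_v\operatorname{trace}_v(\iota f)-\operatorname{strace}_v(\iota f)',\xi^v\big\rangle\quad(v\in V_1)$$ for all $f\in D(H)$, where $\xi^v$ is any element of $X_v$ with $\xi^v(v)=1$. -/

import Mathlib

open MeasureTheory Set Filter Topology
open scoped ContDiff

noncomputable section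

namespace QGraph

/-! ## Finite-dimensional spaces with a weighted scalar product -/

/-- The space of `𝕜`-valued functions on the index set `ι`, provided with the scalar product
`(ξ, η) ↦ ∑ i, ξ i * conj (η i) * w i`, where `w` is a strictly positive weight. -/
def WSpace (𝕜 : Type*) {ι : Type*} (_w : ι → Set.Ioi (0 : ℝ)) : Type _ := ι → 𝕜

section WSpace

variable {𝕜 : Type*} [RCLike 𝕜] {ι : Type*} (w : ι → Set.Ioi (0 : ℝ))

instance : AddCommGroup (WSpace 𝕜 w) := inferInstanceAs (AddCommGroup (ι → 𝕜))

instance : Module 𝕜 (WSpace 𝕜 w) := inferInstanceAs (Module 𝕜 (ι → 𝕜))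

instance [Finite ι] : FiniteDimensional 𝕜 (WSpace 𝕜 w) :=
  inferInstanceAs (FiniteDimensional 𝕜 (ι → 𝕜))

theorem WSpace.add_apply (x y : WSpace 𝕜 w) (i : ι) : (x + y) i = x i + y i := rfl

theorem WSpace.smul_apply (r : 𝕜) (x : WSpace 𝕜 w) (i : ι) : (r • x) i = r * x i := rfl

/-- As everywhere in Mathlib, `inner 𝕜 x y` is conjugate linear in `x` and linear in `y`; thus the
scalar product `(ξ | η)` that is linear in the first argument is `inner 𝕜 η ξ`. -/
@[reducible] def WSpace.core [Fintype ι] : InnerProductSpace.Core 𝕜 (WSpace 𝕜 w) where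
  inner x y := ∑ i, y i * (starRingEnd 𝕜) (x i) * ((w i : ℝ) : 𝕜)
  conj_inner_symm x y := by
    rw [map_sum]
    refine Finset.sum_congr rfl fun i _ => ?_
    simp only [map_mul, RCLike.conj_conj, RCLike.conj_ofReal]
    ring
  re_inner_nonneg x := by
    rw [map_sum]
    refine Finset.sum_nonneg fun i _ => ?_
    rw [RCLike.mul_conj, ← RCLike.ofReal_pow, ← RCLike.ofReal_mul, RCLike.ofReal_re]
    exact mul_nonneg (sq_nonneg _) (le_of_lt (w i).2)
  add_left x y z := by
    rw [← Finset.sum_add_distrib]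
    refine Finset.sum_congr rfl fun i _ => ?_
    rw [WSpace.add_apply, map_add]
    ring
  smul_left x y r := by
    rw [Finset.mul_sum]
    refine Finset.sum_congr rfl fun i _ => ?_
    rw [WSpace.smul_apply, map_mul]
    ring
  definite x hx := by
    have h1 : ∀ i, x i * (starRingEnd 𝕜) (x i) * ((w i : ℝ) : 𝕜)
        = ((‖x i‖ ^ 2 * (w i : ℝ) : ℝ) : 𝕜) := by
      intro i
      rw [RCLike.mul_conj]
      push_cast
      rfl
    simp only [h1] at hx
    rw [← RCLike.ofReal_sum, RCLike.ofReal_eq_zero, Finset.sum_eq_zero_iff_of_nonneg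
      (fun i _ => mul_nonneg (sq_nonneg _) (le_of_lt (w i).2))] at hx
    funext i
    have h2 := hx i (Finset.mem_univ i)
    have h3 : ‖x i‖ ^ 2 = 0 := by
      rcases mul_eq_zero.mp h2 with h | h
      · exact h
      · exact absurd h (ne_of_gt (w i).2)
    exact norm_eq_zero.mp (pow_eq_zero_iff (two_ne_zero) |>.mp h3)

instance [Fintype ι] : NormedAddCommGroup (WSpace 𝕜 w) :=
  (WSpace.core (𝕜 := 𝕜) w).toNormedAddCommGroup

instance [Fintype ι] : InnerProductSpace 𝕜 (WSpace 𝕜 w) :=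
  InnerProductSpace.ofCore (WSpace.core (𝕜 := 𝕜) w).toCore

end WSpace

/-- The vector `L x` for an operator `L` in the subspace `X`. (The value `0` for `x ∉ X` is a
convention which is never used below: `x ∈ X` is always required separately.) -/
def applyOn {𝕜 F : Type*} [RCLike 𝕜] [AddCommGroup F] [Module 𝕜 F] (X : Submodule 𝕜 F)
    (L : X →ₗ[𝕜] X) (x : F) : F :=
  open Classical in if h : x ∈ X then (L ⟨x, h⟩ : F) else 0

/-! ## The one-dimensional case

Functions on `[a, b]` are represented by functions on `ℝ` of which only the restriction to
`[a, b]` (or to `(a, b)`) matters. -/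

section Interval

variable {𝕜 : Type*} [RCLike 𝕜]

/-- The distributional derivative of `f` on the open interval `(a, b)` is the density `g` times
the measure `ν`, i.e. `f' = g ν` in the sense of distributions. -/
def HasDistribDeriv (a b : ℝ) (ν : Measure ℝ) (f g : ℝ → 𝕜) : Prop :=
  LocallyIntegrableOn f (Ioo a b) volume ∧ LocallyIntegrableOn g (Ioo a b) ν ∧
  ∀ φ : ℝ → ℝ, ContDiff ℝ ∞ φ → HasCompactSupport φ → tsupport φ ⊆ Ioo a b →
    ∫ x in Ioo a b, deriv φ x • f x = - ∫ x in Ioo a b, φ x • g x ∂ν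

/-- Membership in `W^1_2(a, b) ∩ C[a, b]`. -/
def MemW12 (a b : ℝ) (f : ℝ → 𝕜) : Prop :=
  ContinuousOn f (Icc a b) ∧ MemLp f 2 (volume.restrict (Ioo a b)) ∧
  ∃ g : ℝ → 𝕜, MemLp g 2 (volume.restrict (Ioo a b)) ∧ HasDistribDeriv a b volume f g

/-- `f` is affine linear on each of the components of `[a, b] \ spt μ`. -/
def AffineOffSupport (a b : ℝ) (μ : Measure ℝ) (f : ℝ → 𝕜) : Prop :=
  ∀ x ∈ Icc a b \ μ.support, ∃ α β : 𝕜,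
    ∀ y ∈ connectedComponentIn (Icc a b \ μ.support) x, f y = α + β * (y : 𝕜)

/-- Membership in `W^1_{2,μ}(a, b)`. -/
def MemW12mu (a b : ℝ) (μ : Measure ℝ) (f : ℝ → 𝕜) : Prop :=
  MemW12 a b f ∧ AffineOffSupport a b μ f

/-- The domain `D(ι)` as a subset of `L_2([a, b], μ)`. -/
def iotaDomain (𝕜 : Type*) [RCLike 𝕜] (a b : ℝ) (μ : Measure ℝ) : Set (Lp 𝕜 2 μ) :=
  {f | ∃ g : ℝ → 𝕜, MemW12 a b g ∧ g =ᵐ[μ] f}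

/-- For `f ∈ D(ι)`, `iota a b μ f` is the element of `W^1_{2,μ}(a, b)` that coincides with `f`
`μ`-a.e. (it is unique as a function on `[a, b]`). -/
def iota (a b : ℝ) (μ : Measure ℝ) (f : Lp 𝕜 2 μ) : ℝ → 𝕜 :=
  open Classical in
  if h : ∃ g : ℝ → 𝕜, MemW12mu a b μ g ∧ g =ᵐ[μ] f then h.choose else 0

/-- The weak derivative `f'` on `(a, b)`, if it exists (it is unique up to equality a.e.). -/
def weakDeriv (a b : ℝ) (f : ℝ → 𝕜) : ℝ → 𝕜 :=
  open Classical in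
  if h : ∃ g : ℝ → 𝕜, HasDistribDeriv a b volume f g then h.choose else 0

/-- `g` is the distributional derivative `∂_μ f` of `f` with respect to `μ`. -/
def HasMuDeriv (a b : ℝ) (μ : Measure ℝ) (f g : ℝ → 𝕜) : Prop :=
  Integrable g μ ∧ HasDistribDeriv a b μ f g

/-- The derivative `∂_μ f` with respect to `μ`, if it exists (it is unique up to equality
`μ`-a.e. if `μ` is concentrated on the open interval `(a, b)`). -/
def muDeriv (a b : ℝ) (μ : Measure ℝ) (f : ℝ → 𝕜) : ℝ → 𝕜 :=
  open Classical in
  if h : ∃ g : ℝ → 𝕜, HasMuDeriv a b μ f g then h.choose else 0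

/-- A representative of bounded variation on `(a, b)` of the a.e.-equivalence class of `f`, if
there is one. (Its limits at `a` and at `b` do not depend on the representative.) -/
def bvRep (a b : ℝ) (f : ℝ → 𝕜) : ℝ → 𝕜 :=
  open Classical in
  if h : ∃ g : ℝ → 𝕜, BoundedVariationOn g (Ioo a b) ∧ g =ᵐ[volume.restrict (Ioo a b)] f
  then h.choose else 0

end Interval

/-! ## The graph -/

/-- A directed graph with vertex set `V` and edge set `E` (loops and multiple edges are allowed),
together with an interval `[a e, b e]` and a finite Borel measure `μ e` on this interval for each
edge `e`, and a weight `m v ≥ 0` for each vertex `v`. The edge `e` starts at the vertex `vtx e 0`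
and ends at the vertex `vtx e 1`. -/
structure MGraph (V E : Type*) where
  vtx : E → Fin 2 → V
  a : E → ℝ
  b : E → ℝ
  a_lt_b : ∀ e, a e < b e
  μ : E → Measure ℝ
  finite_μ : ∀ e, IsFiniteMeasure (μ e)
  μ_compl : ∀ e, μ e (Icc (a e) (b e))ᶜ = 0
  μ_cases : ∀ e, μ e = 0 ∨
    (a e ∈ (μ e).support ∧ b e ∈ (μ e).support ∧ μ e {a e, b e} = 0)
  m : V → ℝ
  m_nonneg : ∀ v, 0 ≤ m v

namespace MGraph

variable {V E : Type*} (G : MGraph V E)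

/-- The edges with mass. -/
def E₁ : Type _ := {e : E // G.μ e ≠ 0}

/-- The vertices with mass. -/
def V₁ : Type _ := {v : V // 0 < G.m v}

instance [Finite E] : Fintype G.E₁ := @Fintype.ofFinite _ (inferInstanceAs (Finite {e : E // G.μ e ≠ 0}))

instance [Finite V] : Fintype G.V₁ := @Fintype.ofFinite _ (inferInstanceAs (Finite {v : V // 0 < G.m v}))

/-- The index set `(E₁ × {0, 1}) ∪ V₁` of boundary values and vertex values. -/
abbrev Idx : Type _ := (G.E₁ × Fin 2) ⊕ G.V₁

/-- The vertex to which an index belongs. -/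
def vertexOf : G.Idx → V
  | Sum.inl p => G.vtx p.1.1 p.2
  | Sum.inr v => v.1

/-- The index set `E_{1,v}` if `v` has no mass, and `E_{1,v} ∪ {v}` if `v` has mass. -/
def LIdx (v : V) : Type _ := {i : G.Idx // G.vertexOf i = v}

instance [Finite V] [Finite E] (v : V) : Fintype (G.LIdx v) :=
  @Fintype.ofFinite _ (inferInstanceAs (Finite {i : G.Idx // G.vertexOf i = v}))

/-- The weights of the scalar product on the vertex values. -/
def vWeight (v : G.V₁) : Set.Ioi (0 : ℝ) := ⟨G.m v.1, v.2⟩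

/-- The weights of the scalar product on the boundary and vertex values: `1` for `(e, j)`, and the
mass of `v` for `v`. -/
def weight : G.Idx → Set.Ioi (0 : ℝ)
  | Sum.inl _ => ⟨1, Set.mem_Ioi.mpr one_pos⟩
  | Sum.inr v => G.vWeight v

/-- The index of a vertex with mass among the indices belonging to this vertex. -/
def vIdx {v : V} (hv : 0 < G.m v) : G.LIdx v := ⟨Sum.inr ⟨v, hv⟩, rfl⟩

variable (𝕜 : Type*) [RCLike 𝕜]

/-- The Hilbert space `⨁_{e ∈ E₁} L_2([a_e, b_e], μ_e)`. -/
abbrev HE [Finite E] : Type _ := PiLp 2 (fun e : G.E₁ => Lp 𝕜 2 (G.μ e.1))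

/-- The Hilbert space `ℋ_Γ`. -/
abbrev HΓ [Finite V] [Finite E] : Type _ := WithLp 2 (G.HE 𝕜 × WSpace 𝕜 G.vWeight)

/-- The space of all boundary and vertex values. -/
abbrev TSpace : Type _ := WSpace 𝕜 G.weight

/-- The space of the boundary and vertex values that belong to the vertex `v`. -/
abbrev LSpace (v : V) : Type _ := WSpace 𝕜 (fun i : G.LIdx v => G.weight i.1)

variable {𝕜}

/-- Restriction of boundary and vertex values to those belonging to `v`. -/
def restr (v : V) (ξ : G.TSpace 𝕜) : G.LSpace 𝕜 v := fun i => ξ i.1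

/-- The trace mapping. -/
def trace (u : G.E₁ → ℝ → 𝕜) (z : G.V₁ → 𝕜) : G.TSpace 𝕜
  | Sum.inl (e, j) => if j = 0 then u e (G.a e.1) else u e (G.b e.1)
  | Sum.inr v => z v

/-- The signed trace of functions that have representatives of bounded variation, with the value
`0` at the vertices. -/
def strace (u : G.E₁ → ℝ → 𝕜) : G.TSpace 𝕜
  | Sum.inl (e, j) =>
      if j = 0 then Function.rightLim (bvRep (G.a e.1) (G.b e.1) (u e)) (G.a e.1)
      else - Function.leftLim (bvRep (G.a e.1) (G.b e.1) (u e)) (G.b e.1)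
  | Sum.inr _ => 0

section

variable [Finite V] [Finite E]

/-- The edge components of `ι f`. -/
def iotaE (f : G.HE 𝕜) (e : G.E₁) : ℝ → 𝕜 := iota (G.a e.1) (G.b e.1) (G.μ e.1) (f e)

/-- The derivatives `(ι_e f_e)'`. -/
def diotaE (f : G.HE 𝕜) (e : G.E₁) : ℝ → 𝕜 := weakDeriv (G.a e.1) (G.b e.1) (G.iotaE f e)

/-- The boundary and vertex values `trace (ι f)`. -/
def tr (f : G.HΓ 𝕜) : G.TSpace 𝕜 := G.trace (G.iotaE f.fst) f.snd

/-- The signed boundary values `strace (ι f)'`. -/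
def str (f : G.HΓ 𝕜) : G.TSpace 𝕜 := G.strace (G.diotaE f.fst)

/-- The domain of the form `τ` determined by the subspace `X`. -/
def formDomain (X : Submodule 𝕜 (G.TSpace 𝕜)) : Set (G.HΓ 𝕜) :=
  {f | (∀ e, f.fst e ∈ iotaDomain 𝕜 (G.a e.1) (G.b e.1) (G.μ e.1)) ∧ G.tr f ∈ X}

/-- The form `τ` determined by the subspace `X` and the operator `L` in `X`. -/
def form (X : Submodule 𝕜 (G.TSpace 𝕜)) (L : X →ₗ[𝕜] X) (f g : G.HΓ 𝕜) : 𝕜 :=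
  (∑ e : G.E₁, ∫ x in Ioo (G.a e.1) (G.b e.1),
      G.diotaE f.fst e x * (starRingEnd 𝕜) (G.diotaE g.fst e x))
    + inner 𝕜 (G.tr g) (applyOn X L (G.tr f))

/-- `H` is the operator associated with the form `τ`: one has `f ∈ D(H)` and `H f = h` if and only
if `f ∈ D(τ)` and `τ(f, g) = (h | g)` for all `g ∈ D(τ)`. -/
def IsAssociated (X : Submodule 𝕜 (G.TSpace 𝕜)) (L : X →ₗ[𝕜] X)
    (H : G.HΓ 𝕜 →ₗ.[𝕜] G.HΓ 𝕜) : Prop :=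
  ∀ f h : G.HΓ 𝕜, (f, h) ∈ H.graph ↔
    f ∈ G.formDomain X ∧ ∀ g ∈ G.formDomain X, G.form X L f g = inner 𝕜 g h

/-- The domain of the maximal operator `Ĥ`. -/
def hatDomain : Set (G.HE 𝕜) :=
  {f | ∀ e : G.E₁, f e ∈ iotaDomain 𝕜 (G.a e.1) (G.b e.1) (G.μ e.1) ∧
    IntegrableOn (G.diotaE f e) (Ioo (G.a e.1) (G.b e.1)) volume ∧
    (∃ g : ℝ → 𝕜, HasMuDeriv (G.a e.1) (G.b e.1) (G.μ e.1) (G.diotaE f e) g) ∧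
    MemLp (muDeriv (G.a e.1) (G.b e.1) (G.μ e.1) (G.diotaE f e)) 2 (G.μ e.1)}

/-- The maximal operator `Ĥ f = (-∂_{μ_e} (ι_e f_e)')_e`, for `f` in its domain. -/
def hatH (f : G.HE 𝕜) : G.HE 𝕜 := WithLp.toLp 2 fun e =>
  open Classical in
  if h : MemLp (muDeriv (G.a e.1) (G.b e.1) (G.μ e.1) (G.diotaE f e)) 2 (G.μ e.1)
  then - h.toLp _ else 0

end

/-- The boundary conditions given by `X` and `L` are local: `X` is the direct sum of the `Xv v`
and `L` is the direct sum of the `Lv v`, with respect to the decomposition of the set of indices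
according to the vertices to which they belong. -/
structure IsLocal (X : Submodule 𝕜 (G.TSpace 𝕜)) (L : X →ₗ[𝕜] X)
    (Xv : ∀ v : V, Submodule 𝕜 (G.LSpace 𝕜 v)) (Lv : ∀ v : V, Xv v →ₗ[𝕜] Xv v) : Prop where
  mem_iff : ∀ ξ : G.TSpace 𝕜, ξ ∈ X ↔ ∀ v, G.restr v ξ ∈ Xv v
  op_eq : ∀ (ξ : X) (v : V), ∃ h : G.restr v ξ ∈ Xv v,
    G.restr v (L ξ : G.TSpace 𝕜) = (Lv v ⟨G.restr v ξ, h⟩ : G.LSpace 𝕜 v)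

/-- The subspace `X_{v,0}`: the elements of `X_v` that vanish at `v` if `v` has mass, and all of
`X_v` otherwise. -/
def localZero {v : V} (Xv : Submodule 𝕜 (G.LSpace 𝕜 v)) : Submodule 𝕜 (G.LSpace 𝕜 v) where
  carrier := {ξ | ξ ∈ Xv ∧ ∀ hv : 0 < G.m v, ξ (G.vIdx hv) = 0}
  add_mem' {x y} hx hy := ⟨Xv.add_mem hx.1 hy.1, fun hv => by
    rw [WSpace.add_apply, hx.2 hv, hy.2 hv, add_zero]⟩
  zero_mem' := ⟨Xv.zero_mem, fun _ => rfl⟩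
  smul_mem' r x hx := ⟨Xv.smul_mem r hx.1, fun hv => by
    rw [WSpace.smul_apply, hx.2 hv, mul_zero]⟩

end MGraph

end QGraph

end

/-! The form identity τ(f, g) = ⟨h, g⟩ is tested with two kinds of g. Elements g living on one edge
with zero boundary values always lie in D(τ), and they yield -∂_μ (ι f)' = h on that edge
(`hasMuDeriv_of_forall_test`, `hasMuDeriv_of_weak`). Once f is in the domain of Ĥ, Green's formula
(`sum_integral_diotaE`) cancels the edge terms. What remains pairs trace(ι g) with L trace(ι f) -
strace(ι f)' minus the vertex values of h. Since the traces of D(τ) fill X (`exists_tr_eq`), this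
vector has to be orthogonal to X (`weak_iff`).

For local boundary conditions this orthogonality decouples into one condition per vertex
(`inner_eq_zero_iff_local`). At a vertex with mass, X_v is spanned by X_{v,0} and ξ^v. Orthogonality
to X_{v,0} does not involve h and is the boundary condition; orthogonality to ξ^v determines the
value of h at v (`local_condition_iff`). As some ξ^v exists at each such vertex, h is determined by
f, so the relation is the graph of an operator.

The analytic obstacle is that a test function φ need not be affine in the gaps of spt μ, so ι of its
class is an interpolant rather than φ. Passing to the interpolant projects the derivative
orthogonally (`exists_interpolating_density`). Hence ∫ (ι f)' conj(v') depends only on the values of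
v on spt μ, and φ may be used after all (`integral_weakDeriv_congr`). Integration by parts against a
measure is Fubini's theorem on a triangle (`integral_mul_primitive`). -/

noncomputable section

namespace QGraph

/-! ## Distributional derivatives and primitives -/

section Distributions

variable {𝕜 : Type*} [RCLike 𝕜] {a b : ℝ} {ν : Measure ℝ}

theorem exists_Ioo_of_isCompact_subset_Ioo (hab : a < b) {K : Set ℝ} (hK : IsCompact K)
    (hKab : K ⊆ Ioo a b) : ∃ c d, a < c ∧ c < d ∧ d < b ∧ K ⊆ Ioo c d := by
  rcases K.eq_empty_or_nonempty with rfl | hne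
  · refine ⟨(2 * a + b) / 3, (a + 2 * b) / 3, by linarith, by linarith, by linarith, by simp⟩
  · obtain ⟨c, hc⟩ := hK.exists_isLeast hne
    obtain ⟨d, hd⟩ := hK.exists_isGreatest hne
    have h1 := hKab hc.1
    have h2 := hKab hd.1
    have h3 : c ≤ d := hc.2 hd.1
    have h4 := h1.1
    have h5 := h2.2
    refine ⟨(a + c) / 2, (d + b) / 2, by linarith [h1.1], by linarith [h1.1, h2.2],
      by linarith [h2.2], fun x hx => ⟨?_, ?_⟩⟩
    · linarith [hc.2 hx, h1.1]
    · linarith [hd.2 hx, h2.2]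

theorem integrable_smul_of_locallyIntegrableOn {f : ℝ → 𝕜}
    (hf : LocallyIntegrableOn f (Ioo a b) ν) {ψ : ℝ → ℝ} (hψ : Continuous ψ)
    (hψc : HasCompactSupport ψ) (hψs : tsupport ψ ⊆ Ioo a b) :
    Integrable (fun x => ψ x • f x) (ν.restrict (Ioo a b)) := by
  have h1 : IntegrableOn f (tsupport ψ) ν := hf.integrableOn_compact_subset hψs hψc
  have h2 : IntegrableOn (fun x => ψ x • f x) (tsupport ψ) ν :=
    h1.continuousOn_smul_of_subset hψ.continuousOn hψc
      (isClosed_tsupport ψ).measurableSet Subset.rfl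
  have h3 : Integrable (fun x => ψ x • f x) ν := by
    rw [← integrableOn_iff_integrable_of_support_subset (s := tsupport ψ)]
    · exact h2
    · intro x hx
      apply subset_tsupport
      simp only [Function.mem_support, ne_eq, smul_eq_zero, not_or] at hx
      exact hx.1
  exact h3.integrableOn

theorem setIntegral_smul_eq_integral {f : ℝ → 𝕜} {ψ : ℝ → ℝ} (hψs : tsupport ψ ⊆ Ioo a b) :
    ∫ x in Ioo a b, ψ x • f x ∂ν = ∫ x, ψ x • f x ∂ν := by
  refine setIntegral_eq_integral_of_forall_compl_eq_zero fun x hx => ?_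
  rw [image_eq_zero_of_notMem_tsupport fun h => hx (hψs h), zero_smul]

theorem ae_eq_zero_of_test {f : ℝ → 𝕜} (hf : LocallyIntegrableOn f (Ioo a b) ν)
    (h : ∀ φ : ℝ → ℝ, ContDiff ℝ ∞ φ → HasCompactSupport φ → tsupport φ ⊆ Ioo a b →
      ∫ x in Ioo a b, φ x • f x ∂ν = 0) : f =ᵐ[ν.restrict (Ioo a b)] 0 := by
  have := isOpen_Ioo.ae_eq_zero_of_integral_contDiff_smul_eq_zero hf fun g h1 h2 h3 => by
    rw [← setIntegral_smul_eq_integral h3]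
    exact h g h1 h2 h3
  exact (ae_restrict_iff' measurableSet_Ioo).2 this

/-- A smooth function with compact support in `(a, b)` and mean value zero is the derivative of
such a function. -/
theorem exists_test_antideriv (hab : a < b) {χ : ℝ → ℝ} (hχ : ContDiff ℝ ∞ χ)
    (hχc : HasCompactSupport χ) (hχs : tsupport χ ⊆ Ioo a b) (h0 : ∫ x, χ x = 0) :
    ∃ φ : ℝ → ℝ, ContDiff ℝ ∞ φ ∧ HasCompactSupport φ ∧ tsupport φ ⊆ Ioo a b ∧ deriv φ = χ := by
  obtain ⟨c, d, hac, hcd, hdb, hK⟩ := exists_Ioo_of_isCompact_subset_Ioo hab hχc hχs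
  have hz : ∀ x, x ∉ Ioo c d → χ x = 0 := fun x hx =>
    image_eq_zero_of_notMem_tsupport fun h => hx (hK h)
  have hd' : ∀ x, HasDerivAt (fun x => ∫ t in c..x, χ t) (χ x) x := fun x =>
    hχ.continuous.integral_hasStrictDerivAt c x |>.hasDerivAt
  have hd : deriv (fun x => ∫ t in c..x, χ t) = χ := funext fun x => (hd' x).deriv
  -- Left of `c` nothing has been integrated yet; right of `d` the whole integral of χ has, which is
  -- zero.
  have hsupp : tsupport (fun x => ∫ t in c..x, χ t) ⊆ Icc c d := by
    refine closure_minimal (fun x hx => ?_) isClosed_Icc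
    by_contra hxn
    refine hx ?_
    rcases lt_or_ge x c with hxc | hxc
    · change ∫ t in c..x, χ t = 0
      rw [intervalIntegral.integral_symm, neg_eq_zero]
      refine intervalIntegral.integral_zero_ae (ae_of_all _ fun t ht => ?_)
      rw [uIoc_of_le hxc.le] at ht
      exact hz t fun h' => (not_lt.2 ht.2) h'.1
    · have hxd : d < x := not_le.1 fun h => hxn ⟨hxc, h⟩
      change ∫ t in c..x, χ t = 0
      rw [intervalIntegral.integral_of_le hxc, ← integral_Icc_eq_integral_Ioc,
        setIntegral_eq_integral_of_forall_compl_eq_zero, h0]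
      intro t ht
      exact hz t fun h' => ht ⟨h'.1.le, h'.2.le.trans hxd.le⟩
  refine ⟨_, ?_, ?_, hsupp.trans (Icc_subset_Ioo hac hdb), hd⟩
  · rw [contDiff_infty_iff_deriv, hd]
    exact ⟨fun x => (hd' x).differentiableAt, hχ⟩
  · exact HasCompactSupport.of_support_subset_isCompact isCompact_Icc
      ((subset_tsupport _).trans hsupp)

/-- The lemma of du Bois-Reymond. -/
theorem ae_eq_const_of_test_deriv (hab : a < b) {f : ℝ → 𝕜}
    (hf : LocallyIntegrableOn f (Ioo a b) volume)
    (h : ∀ φ : ℝ → ℝ, ContDiff ℝ ∞ φ → HasCompactSupport φ → tsupport φ ⊆ Ioo a b →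
      ∫ x in Ioo a b, deriv φ x • f x = 0) :
    ∃ c : 𝕜, f =ᵐ[volume.restrict (Ioo a b)] fun _ => c := by
  obtain ⟨θ, hθ, hθc, hθs, hθ1⟩ : ∃ θ : ℝ → ℝ, ContDiff ℝ ∞ θ ∧ HasCompactSupport θ ∧
      tsupport θ ⊆ Ioo a b ∧ ∫ x, θ x = 1 := by
    let B : ContDiffBump ((a + b) / 2) :=
      ⟨(b - a) / 8, (b - a) / 4, by linarith, by linarith⟩
    refine ⟨B.normed volume, B.contDiff_normed, B.hasCompactSupport_normed, ?_,
      B.integral_normed⟩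
    rw [B.tsupport_normed_eq, Real.closedBall_eq_Icc]
    refine Icc_subset_Ioo ?_ ?_ <;> simp only [B] <;> linarith
  set C : 𝕜 := ∫ x in Ioo a b, θ x • f x with hC
  refine ⟨C, ?_⟩
  have hcl : LocallyIntegrableOn (fun _ : ℝ => C) (Ioo a b) volume := locallyIntegrableOn_const _
  have key : (fun x => f x - C) =ᵐ[volume.restrict (Ioo a b)] 0 := by
    refine ae_eq_zero_of_test (hf.sub hcl) fun ψ hψ hψc hψs => ?_
    -- The function `ψ - m * θ` has mean value zero, so it is the derivative of a test function and
    -- `h` applies to it.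
    set m : ℝ := ∫ x, ψ x with hm
    have hts : tsupport (fun x => ψ x - m * θ x) ⊆ tsupport ψ ∪ tsupport θ := by
      refine closure_minimal (fun x hx => ?_)
        ((isClosed_tsupport _).union (isClosed_tsupport _))
      by_contra hx'
      rw [mem_union, not_or] at hx'
      refine hx ?_
      simp [image_eq_zero_of_notMem_tsupport hx'.1, image_eq_zero_of_notMem_tsupport hx'.2]
    have hψi : Integrable ψ := hψ.continuous.integrable_of_hasCompactSupport hψc
    have hθi : Integrable θ := hθ.continuous.integrable_of_hasCompactSupport hθc
    obtain ⟨φ, h1, h2, h3, h4⟩ := exists_test_antideriv hab (χ := fun x => ψ x - m * θ x)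
      (hψ.sub (contDiff_const.mul hθ))
      (HasCompactSupport.of_support_subset_isCompact (hψc.isCompact.union hθc.isCompact)
        ((subset_tsupport _).trans hts))
      (hts.trans (union_subset hψs hθs))
      (by rw [integral_sub hψi (hθi.const_mul m), integral_const_mul, hθ1, mul_one, sub_self])
    have h5 := h φ h1 h2 h3
    rw [h4] at h5
    have i1 := integrable_smul_of_locallyIntegrableOn hf hψ.continuous hψc hψs
    have i2 := integrable_smul_of_locallyIntegrableOn hf hθ.continuous hθc hθs
    have i3 := integrable_smul_of_locallyIntegrableOn hcl hψ.continuous hψc hψs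
    have h6 : ∫ x in Ioo a b, ψ x • f x = m • C := by
      have : ∫ x in Ioo a b, (ψ x • f x - m • (θ x • f x)) = 0 := by
        rw [← h5]
        refine integral_congr_ae (ae_of_all _ fun x => ?_)
        simp only [sub_smul, mul_smul]
      have i4 : Integrable (fun x => m • (θ x • f x)) (volume.restrict (Ioo a b)) := i2.smul m
      rw [integral_sub i1 i4, integral_smul, ← hC] at this
      exact sub_eq_zero.1 this
    have h7 : ∫ x in Ioo a b, ψ x • C = m • C := by
      rw [setIntegral_smul_eq_integral hψs, integral_smul_const]
    simp only [smul_sub]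
    rw [integral_sub i1 i3, h6, h7, sub_self]
  filter_upwards [key] with x hx
  exact sub_eq_zero.1 hx

/-! ### Calculus of distributional derivatives -/

theorem HasDistribDeriv.congr {f f' g g' : ℝ → 𝕜} (h : HasDistribDeriv a b ν f g)
    (hf : f =ᵐ[volume.restrict (Ioo a b)] f') (hg : g =ᵐ[ν.restrict (Ioo a b)] g') :
    HasDistribDeriv a b ν f' g' := by
  refine ⟨h.1.congr hf, h.2.1.congr hg, fun φ h1 h2 h3 => ?_⟩
  have e1 : ∫ x in Ioo a b, deriv φ x • f' x = ∫ x in Ioo a b, deriv φ x • f x :=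
    integral_congr_ae (by filter_upwards [hf] with x hx; rw [hx])
  have e2 : ∫ x in Ioo a b, φ x • g' x ∂ν = ∫ x in Ioo a b, φ x • g x ∂ν :=
    integral_congr_ae (by filter_upwards [hg] with x hx; rw [hx])
  rw [e1, e2, h.2.2 φ h1 h2 h3]

theorem HasDistribDeriv.unique {f g g' : ℝ → 𝕜} (h : HasDistribDeriv a b ν f g)
    (h' : HasDistribDeriv a b ν f g') : g =ᵐ[ν.restrict (Ioo a b)] g' := by
  have : (fun x => g x - g' x) =ᵐ[ν.restrict (Ioo a b)] 0 := by
    refine ae_eq_zero_of_test (h.2.1.sub h'.2.1) fun ψ h1 h2 h3 => ?_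
    simp only [smul_sub]
    rw [integral_sub (integrable_smul_of_locallyIntegrableOn h.2.1 h1.continuous h2 h3)
      (integrable_smul_of_locallyIntegrableOn h'.2.1 h1.continuous h2 h3)]
    have e := h.2.2 ψ h1 h2 h3
    rw [h'.2.2 ψ h1 h2 h3, neg_inj] at e
    rw [e, sub_self]
  filter_upwards [this] with x hx
  exact sub_eq_zero.1 hx

theorem HasDistribDeriv.add {f f' g g' : ℝ → 𝕜} (h : HasDistribDeriv a b ν f g)
    (h' : HasDistribDeriv a b ν f' g') :
    HasDistribDeriv a b ν (fun x => f x + f' x) (fun x => g x + g' x) := by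
  refine ⟨h.1.add h'.1, h.2.1.add h'.2.1, fun φ h1 h2 h3 => ?_⟩
  have d1 := (contDiff_infty_iff_deriv.1 h1).2.continuous
  have d3 := tsupport_deriv_subset.trans h3
  simp only [smul_add]
  rw [integral_add (integrable_smul_of_locallyIntegrableOn h.1 d1 h2.deriv d3)
      (integrable_smul_of_locallyIntegrableOn h'.1 d1 h2.deriv d3),
    integral_add (integrable_smul_of_locallyIntegrableOn h.2.1 h1.continuous h2 h3)
      (integrable_smul_of_locallyIntegrableOn h'.2.1 h1.continuous h2 h3),
    h.2.2 φ h1 h2 h3, h'.2.2 φ h1 h2 h3, neg_add]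

theorem HasDistribDeriv.const_mul {f g : ℝ → 𝕜} (h : HasDistribDeriv a b ν f g) (c : 𝕜) :
    HasDistribDeriv a b ν (fun x => c * f x) (fun x => c * g x) := by
  refine ⟨h.1.smul c, h.2.1.smul c, fun φ h1 h2 h3 => ?_⟩
  have e : ∀ (r : ℝ) (z : 𝕜), r • (c * z) = c * (r • z) := fun r z => (mul_smul_comm r c z).symm
  simp only [e]
  rw [integral_const_mul, integral_const_mul, h.2.2 φ h1 h2 h3, mul_neg]

/-! ### Primitives of densities and Fubini on the triangle -/

/-- The primitive of the measure with density `g` with respect to `ν`. -/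
def primitive (a : ℝ) (ν : Measure ℝ) (g : ℝ → 𝕜) (x : ℝ) : 𝕜 := ∫ y in Ioc a x, g y ∂ν

/-- With a domain of integration that does not depend on `x`, Fubini's theorem and dominated
convergence become applicable. -/
theorem primitive_eq_indicator {g : ℝ → 𝕜} {x : ℝ} (hx : x ∈ Ioo a b) :
    primitive a ν g x = ∫ y in Ioo a b, (Iic x).indicator g y ∂ν := by
  rw [setIntegral_indicator measurableSet_Iic, primitive]
  congr 2
  ext y
  simp only [mem_Ioc, mem_inter_iff, mem_Ioo, mem_Iic]
  exact ⟨fun h => ⟨⟨h.1, h.2.trans_lt hx.2⟩, h.2⟩, fun h => ⟨h.1.1, h.2⟩⟩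

theorem integrable_triangle [SFinite ν] {k g : ℝ → 𝕜} (hk : IntegrableOn k (Ioo a b) volume)
    (hg : IntegrableOn g (Ioo a b) ν) :
    Integrable (fun p : ℝ × ℝ => k p.1 * (Iic p.1).indicator g p.2)
      ((volume.restrict (Ioo a b)).prod (ν.restrict (Ioo a b))) := by
  have h := (Integrable.mul_prod hk hg).indicator
    (measurableSet_le measurable_snd measurable_fst : MeasurableSet {p : ℝ × ℝ | p.2 ≤ p.1})
  refine h.congr (ae_of_all _ fun p => ?_)
  by_cases hp : p.2 ≤ p.1
  · simp [indicator, hp]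
  · simp [indicator, hp]

theorem integrableOn_mul_primitive [SFinite ν] {k g : ℝ → 𝕜}
    (hk : IntegrableOn k (Ioo a b) volume) (hg : IntegrableOn g (Ioo a b) ν) :
    IntegrableOn (fun x => k x * primitive a ν g x) (Ioo a b) volume := by
  have h := (integrable_triangle hk hg).integral_prod_left
  refine h.congr ?_
  filter_upwards [ae_restrict_mem measurableSet_Ioo] with x hx
  rw [integral_const_mul, primitive_eq_indicator hx]

theorem integrableOn_primitive [SFinite ν] {g : ℝ → 𝕜} (hg : IntegrableOn g (Ioo a b) ν) :
    IntegrableOn (primitive a ν g) (Ioo a b) volume := by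
  have h := integrableOn_mul_primitive (k := fun _ => (1 : 𝕜)) (integrableOn_const (by simp)) hg
  simpa only [one_mul] using h

/-- Fubini on the triangle y ≤ x. The diagonal may carry mass for `ν`, but the inner integral is
with respect to Lebesgue measure, so including or excluding the point `y` makes no difference. -/
theorem integral_mul_primitive [SFinite ν] {k g : ℝ → 𝕜}
    (hk : IntegrableOn k (Ioo a b) volume) (hg : IntegrableOn g (Ioo a b) ν) :
    ∫ x in Ioo a b, k x * primitive a ν g x =
      ∫ y in Ioo a b, (∫ x in Ioo y b, k x) * g y ∂ν := by
  have h := integral_integral_swap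
    (f := fun x y : ℝ => k x * (Iic x).indicator g y) (integrable_triangle hk hg)
  have e1 : ∫ x in Ioo a b, k x * primitive a ν g x =
      ∫ x in Ioo a b, ∫ y in Ioo a b, k x * (Iic x).indicator g y ∂ν := by
    refine setIntegral_congr_fun measurableSet_Ioo fun x hx => ?_
    rw [integral_const_mul, primitive_eq_indicator hx]
  rw [e1, h]
  refine setIntegral_congr_fun measurableSet_Ioo fun y hy => ?_
  rw [← integral_mul_const, ← integral_Ico_eq_integral_Ioo (x := y)]
  have : Ico y b = Ioo a b ∩ Ici y := by
    ext x
    simp only [mem_Ico, mem_inter_iff, mem_Ioo, mem_Ici]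
    exact ⟨fun h => ⟨⟨hy.1.trans_le h.1, h.2⟩, h.1⟩, fun h => ⟨h.2, h.1.2⟩⟩
  rw [this, ← setIntegral_indicator measurableSet_Ici]
  refine integral_congr_ae (ae_of_all _ fun x => ?_)
  by_cases hx : y ≤ x <;> simp [indicator, hx]

/-- Fubini with `k = φ'`: the inner integral of φ' over (y, b) is -φ(y), because φ vanishes at `b`.
-/
theorem hasDistribDeriv_primitive [SFinite ν] {g : ℝ → 𝕜} (hg : IntegrableOn g (Ioo a b) ν)
    (c : 𝕜) : HasDistribDeriv a b ν (fun x => c + primitive a ν g x) g := by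
  have hp := integrableOn_primitive hg
  refine ⟨(locallyIntegrableOn_const c).add hp.locallyIntegrableOn, hg.locallyIntegrableOn,
    fun φ h1 h2 h3 => ?_⟩
  have d1 := (contDiff_infty_iff_deriv.1 h1).2.continuous
  have d3 := tsupport_deriv_subset.trans h3
  have di : Integrable (deriv φ) := d1.integrable_of_hasCompactSupport h2.deriv
  have hd : ∀ y ∈ Icc a b, ∫ x in Ioo y b, deriv φ x = - φ y := by
    intro y hy
    have hyb := hy.2
    rw [← integral_Ioc_eq_integral_Ioo, ← intervalIntegral.integral_of_le hyb,
      intervalIntegral.integral_deriv_eq_sub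
        (fun x _ => (contDiff_infty_iff_deriv.1 h1).1 x) (d1.intervalIntegrable _ _),
      image_eq_zero_of_notMem_tsupport fun h => lt_irrefl b (h3 h).2, zero_sub]
  have hk : IntegrableOn (fun x => ((deriv φ x : ℝ) : 𝕜)) (Ioo a b) volume := di.ofReal.integrableOn
  have e := integral_mul_primitive hk hg
  have e2 : ∫ x in Ioo a b, deriv φ x • primitive a ν g x = - ∫ x in Ioo a b, φ x • g x ∂ν := by
    simp only [RCLike.real_smul_eq_coe_mul]
    rw [e, ← integral_neg]
    refine setIntegral_congr_fun measurableSet_Ioo fun y hy => ?_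
    rw [integral_ofReal, hd y (Ioo_subset_Icc_self hy)]
    push_cast
    ring
  have e3 : ∫ x in Ioo a b, deriv φ x • c = 0 := by
    rcases le_or_gt a b with hab | hab
    · rw [integral_smul_const, hd a ⟨le_rfl, hab⟩,
        image_eq_zero_of_notMem_tsupport fun h => lt_irrefl a (h3 h).1]
      simp
    · simp [Ioo_eq_empty (not_lt.2 hab.le)]
  simp only [smul_add]
  rw [integral_add (integrable_smul_of_locallyIntegrableOn (locallyIntegrableOn_const c) d1
    h2.deriv d3) (integrable_smul_of_locallyIntegrableOn hp.locallyIntegrableOn d1 h2.deriv d3),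
    e2, e3, zero_add]

/-- Two functions with the same distributional derivative differ by a constant, by du Bois-Reymond;
one of them is the primitive. -/
theorem HasDistribDeriv.ae_eq_primitive [SFinite ν] (hab : a < b) {f g : ℝ → 𝕜}
    (h : HasDistribDeriv a b ν f g) (hg : IntegrableOn g (Ioo a b) ν) :
    ∃ c : 𝕜, f =ᵐ[volume.restrict (Ioo a b)] fun x => c + primitive a ν g x := by
  have h' : HasDistribDeriv a b ν (primitive a ν g) g := by
    simpa only [zero_add] using hasDistribDeriv_primitive hg 0
  obtain ⟨c, hc⟩ := ae_eq_const_of_test_deriv hab (h.1.sub h'.1) fun φ h1 h2 h3 => by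
    have d1 := (contDiff_infty_iff_deriv.1 h1).2.continuous
    have d3 := tsupport_deriv_subset.trans h3
    simp only [Pi.sub_apply, smul_sub]
    rw [integral_sub (integrable_smul_of_locallyIntegrableOn h.1 d1 h2.deriv d3)
      (integrable_smul_of_locallyIntegrableOn h'.1 d1 h2.deriv d3), h.2.2 φ h1 h2 h3]
    have := h'.2.2 φ h1 h2 h3
    rw [this, sub_self]
  refine ⟨c, ?_⟩
  filter_upwards [hc] with x hx
  rw [← hx]
  simp

end Distributions

/-! ## Sobolev functions and functions of bounded variation on an interval -/

section Sobolev

variable {𝕜 : Type*} [RCLike 𝕜] {a b : ℝ} {ν : Measure ℝ}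

theorem integrableOn_of_memLp_two {k : ℝ → 𝕜} (hk : MemLp k 2 (volume.restrict (Ioo a b))) :
    IntegrableOn k (Ioo a b) volume :=
  hk.integrable one_le_two

theorem integrableOn_Icc_of_Ioo {k : ℝ → 𝕜} (hk : IntegrableOn k (Ioo a b) volume) :
    IntegrableOn k (Icc a b) volume :=
  (integrableOn_Icc_iff_integrableOn_Ioo (by finiteness) (by finiteness)).2 hk

theorem continuousOn_primitive {k : ℝ → 𝕜} (hk : IntegrableOn k (Ioo a b) volume) :
    ContinuousOn (primitive a volume k) (Icc a b) :=
  intervalIntegral.continuousOn_primitive (integrableOn_Icc_of_Ioo hk)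

theorem primitive_congr {k k' : ℝ → 𝕜} (h : k =ᵐ[volume.restrict (Ioo a b)] k') {x : ℝ}
    (hx : x ∈ Icc a b) : primitive a volume k x = primitive a volume k' x := by
  rw [primitive, primitive, integral_Ioc_eq_integral_Ioo, integral_Ioc_eq_integral_Ioo]
  exact integral_congr_ae (ae_restrict_of_ae_restrict_of_subset (Ioo_subset_Ioo_right hx.2) h)

theorem primitive_left (k : ℝ → 𝕜) : primitive a ν k a = 0 := by
  simp [primitive]

theorem integral_Ioo_eq_primitive_sub {k : ℝ → 𝕜} (hk : IntegrableOn k (Ioo a b) volume)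
    {x y : ℝ} (hx : x ∈ Icc a b) (hy : y ∈ Icc a b) (hxy : x ≤ y) :
    ∫ t in Ioo x y, k t = primitive a volume k y - primitive a volume k x := by
  have hi : ∀ z ∈ Icc a b, IntervalIntegrable k volume a z := fun z hz =>
    (intervalIntegrable_iff_integrableOn_Ioo_of_le hz.1).2
      (hk.mono_set (Ioo_subset_Ioo_right hz.2))
  rw [primitive, primitive, ← intervalIntegral.integral_of_le hx.1,
    ← intervalIntegral.integral_of_le hy.1,
    intervalIntegral.integral_interval_sub_left (hi y hy) (hi x hx),
    intervalIntegral.integral_of_le hxy, integral_Ioc_eq_integral_Ioo]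

theorem eqOn_Icc_of_ae_eq_Ioo (hab : a < b) {f g : ℝ → 𝕜} (hf : ContinuousOn f (Icc a b))
    (hg : ContinuousOn g (Icc a b)) (h : f =ᵐ[volume.restrict (Ioo a b)] g) :
    EqOn f g (Icc a b) := by
  rw [Measure.restrict_congr_set Ioo_ae_eq_Icc] at h
  exact Measure.eqOn_Icc_of_ae_eq volume hab.ne h hf hg

theorem memLp_of_continuousOn [IsFiniteMeasure (ν.restrict (Ioo a b))] {f : ℝ → 𝕜}
    (hf : ContinuousOn f (Icc a b)) : MemLp f 2 (ν.restrict (Ioo a b)) := by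
  obtain ⟨C, hC⟩ := isCompact_Icc.exists_bound_of_continuousOn hf
  refine MemLp.of_bound ((hf.mono Ioo_subset_Icc_self).aestronglyMeasurable measurableSet_Ioo) C ?_
  filter_upwards [ae_restrict_mem measurableSet_Ioo] with x hx
  exact hC x (Ioo_subset_Icc_self hx)

theorem memW12_primitive {k : ℝ → 𝕜} (hk : MemLp k 2 (volume.restrict (Ioo a b))) (c : 𝕜) :
    MemW12 a b (fun x => c + primitive a volume k x) := by
  have hki := integrableOn_of_memLp_two hk
  have hc : ContinuousOn (fun x => c + primitive a volume k x) (Icc a b) :=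
    continuousOn_const.add (continuousOn_primitive hki)
  exact ⟨hc, memLp_of_continuousOn hc, k, hk, hasDistribDeriv_primitive hki c⟩

theorem ae_eq_of_eqOn_Icc {F : Type*} {f g : ℝ → F} (h : EqOn f g (Icc a b)) :
    f =ᵐ[ν.restrict (Ioo a b)] g := by
  filter_upwards [ae_restrict_mem measurableSet_Ioo] with x hx
  exact h (Ioo_subset_Icc_self hx)

theorem MemW12.congr {f g : ℝ → 𝕜} (hf : MemW12 a b f) (h : EqOn f g (Icc a b)) :
    MemW12 a b g := by
  obtain ⟨h1, h2, k, h3, h4⟩ := hf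
  have hae : f =ᵐ[volume.restrict (Ioo a b)] g := ae_eq_of_eqOn_Icc h
  exact ⟨h1.congr h.symm, h2.ae_eq hae, k, h3, h4.congr hae (ae_eq_refl _)⟩

theorem MemW12.add {f g : ℝ → 𝕜} (hf : MemW12 a b f) (hg : MemW12 a b g) :
    MemW12 a b (fun x => f x + g x) := by
  obtain ⟨h1, h2, k, h3, h4⟩ := hf
  obtain ⟨h1', h2', k', h3', h4'⟩ := hg
  exact ⟨h1.add h1', h2.add h2', _, h3.add h3', h4.add h4'⟩

theorem MemW12.const_mul {f : ℝ → 𝕜} (hf : MemW12 a b f) (c : 𝕜) :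
    MemW12 a b (fun x => c * f x) := by
  obtain ⟨h1, h2, k, h3, h4⟩ := hf
  exact ⟨continuousOn_const.mul h1, h2.const_mul c, _, h3.const_mul c, h4.const_mul c⟩

theorem HasDistribDeriv.weakDeriv {f k : ℝ → 𝕜} (h : HasDistribDeriv a b volume f k) :
    HasDistribDeriv a b volume f (weakDeriv a b f) := by
  have h' : ∃ g : ℝ → 𝕜, HasDistribDeriv a b volume f g := ⟨k, h⟩
  rw [QGraph.weakDeriv, dif_pos h']
  exact h'.choose_spec

theorem HasDistribDeriv.weakDeriv_ae_eq {f k : ℝ → 𝕜} (h : HasDistribDeriv a b volume f k) :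
    QGraph.weakDeriv a b f =ᵐ[volume.restrict (Ioo a b)] k :=
  h.weakDeriv.unique h

theorem MemW12.hasDistribDeriv {f : ℝ → 𝕜} (hf : MemW12 a b f) :
    HasDistribDeriv a b volume f (weakDeriv a b f) := by
  obtain ⟨-, -, k, -, h⟩ := hf
  exact h.weakDeriv

theorem MemW12.memLp_weakDeriv {f : ℝ → 𝕜} (hf : MemW12 a b f) :
    MemLp (weakDeriv a b f) 2 (volume.restrict (Ioo a b)) := by
  obtain ⟨-, -, k, h1, h⟩ := hf
  exact h1.ae_eq h.weakDeriv_ae_eq.symm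

theorem MemW12.integrableOn_weakDeriv {f : ℝ → 𝕜} (hf : MemW12 a b f) :
    IntegrableOn (weakDeriv a b f) (Ioo a b) volume :=
  integrableOn_of_memLp_two hf.memLp_weakDeriv

/-- Both sides are continuous up to the endpoints, so the a.e. identity holds everywhere and fixes
the constant at `a`. -/
theorem MemW12.eq_primitive (hab : a < b) {f : ℝ → 𝕜} (hf : MemW12 a b f) :
    EqOn f (fun x => f a + primitive a volume (QGraph.weakDeriv a b f) x) (Icc a b) := by
  obtain ⟨c, hc⟩ := hf.hasDistribDeriv.ae_eq_primitive hab hf.integrableOn_weakDeriv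
  have h := eqOn_Icc_of_ae_eq_Ioo hab hf.1
    (continuousOn_const.add (continuousOn_primitive hf.integrableOn_weakDeriv)) hc
  have ha : f a = c + primitive a volume (QGraph.weakDeriv a b f) a := h (left_mem_Icc.2 hab.le)
  rw [primitive_left, add_zero] at ha
  rwa [ha]

theorem MemW12.integral_weakDeriv (hab : a < b) {f : ℝ → 𝕜} (hf : MemW12 a b f) {x y : ℝ}
    (hx : x ∈ Icc a b) (hy : y ∈ Icc a b) (hxy : x ≤ y) :
    ∫ t in Ioo x y, weakDeriv a b f t = f y - f x := by
  rw [integral_Ioo_eq_primitive_sub hf.integrableOn_weakDeriv hx hy hxy,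
    hf.eq_primitive hab hx, hf.eq_primitive hab hy]
  ring

theorem weakDeriv_ae_eq_of_eqOn {f g : ℝ → 𝕜} (hf : MemW12 a b f) (h : EqOn f g (Icc a b)) :
    weakDeriv a b f =ᵐ[volume.restrict (Ioo a b)] weakDeriv a b g :=
  (hf.hasDistribDeriv.congr (ae_eq_of_eqOn_Icc h) (ae_eq_refl _)).weakDeriv_ae_eq.symm

theorem HasMuDeriv.muDeriv {f g : ℝ → 𝕜} (h : HasMuDeriv a b ν f g) :
    HasMuDeriv a b ν f (muDeriv a b ν f) := by
  have h' : ∃ g : ℝ → 𝕜, HasMuDeriv a b ν f g := ⟨g, h⟩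
  rw [QGraph.muDeriv, dif_pos h']
  exact h'.choose_spec

/-! ### One-sided limits of primitives -/

theorem boundedVariationOn_of_edist_le {E F : Type*} [PseudoEMetricSpace E]
    [PseudoEMetricSpace F] {f : ℝ → E} {G : ℝ → F} {s : Set ℝ}
    (hG : BoundedVariationOn G s)
    (h : ∀ x ∈ s, ∀ y ∈ s, x ≤ y → edist (f y) (f x) ≤ edist (G y) (G x)) :
    BoundedVariationOn f s := by
  refine ne_top_of_le_ne_top hG (iSup_le fun p => ?_)
  refine le_trans (Finset.sum_le_sum fun i _ => ?_)
    (eVariationOn.sum_le (f := G) (n := p.1) p.2.2.1 p.2.2.2)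
  exact h _ (p.2.2.2 i) _ (p.2.2.2 (i + 1)) (p.2.2.1 (Nat.le_succ i))

theorem boundedVariationOn_primitive {g : ℝ → 𝕜} (hg : IntegrableOn g (Ioo a b) ν)
    (c : 𝕜) : BoundedVariationOn (fun x => c + primitive a ν g x) (Ioo a b) := by
  have hgn : IntegrableOn (fun y => ‖g y‖) (Ioo a b) ν := hg.norm
  -- Intersecting with `Ioo a b` makes `G` finite and monotone on all of ℝ; it dominates the
  -- increments of the primitive.
  set G : ℝ → ℝ := fun x => ∫ y in Ioo a b ∩ Iic x, ‖g y‖ ∂ν with hG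
  have hmono : Monotone G := fun x y hxy =>
    setIntegral_mono_set (hgn.mono_set inter_subset_left) (ae_of_all _ fun _ => norm_nonneg _)
      (inter_subset_inter_right _ (Iic_subset_Iic.2 hxy)).eventuallyLE
  have hGbv : BoundedVariationOn G (Ioo a b) := by
    have h1 := (hmono.monotoneOn univ).eVariationOn_eq (mem_univ a) (mem_univ b)
    rw [univ_inter] at h1
    exact BoundedVariationOn.mono (ne_top_of_le_ne_top ENNReal.ofReal_ne_top h1.le)
      Ioo_subset_Icc_self
  refine boundedVariationOn_of_edist_le hGbv fun x hx y hy hxy => ?_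
  have hI : ∀ z ∈ Ioo a b, Ioo a b ∩ Iic z = Ioc a z := fun z hz => by
    ext t
    simp only [mem_inter_iff, mem_Ioo, mem_Iic, mem_Ioc]
    exact ⟨fun h => ⟨h.1.1, h.2⟩, fun h => ⟨⟨h.1, h.2.trans_lt hz.2⟩, h.2⟩⟩
  have hsub : ∀ z ∈ Ioo a b, Ioc a z ⊆ Ioo a b := fun z hz t ht => ⟨ht.1, ht.2.trans_lt hz.2⟩
  have hun : Ioc a x ∪ Ioc x y = Ioc a y := Ioc_union_Ioc_eq_Ioc hx.1.le hxy
  have hdis : Disjoint (Ioc a x) (Ioc x y) := Ioc_disjoint_Ioc_of_le le_rfl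
  have hxyab : Ioc x y ⊆ Ioo a b := fun t ht => ⟨hx.1.trans ht.1, ht.2.trans_lt hy.2⟩
  have e1 : primitive a ν g y - primitive a ν g x = ∫ t in Ioc x y, g t ∂ν := by
    rw [primitive, primitive, ← hun, setIntegral_union hdis measurableSet_Ioc
      (hg.mono_set (hsub x hx)) (hg.mono_set hxyab)]
    ring
  have e2 : G y - G x = ∫ t in Ioc x y, ‖g t‖ ∂ν := by
    simp only [hG]
    rw [hI x hx, hI y hy, ← hun, setIntegral_union hdis measurableSet_Ioc
      (hgn.mono_set (hsub x hx)) (hgn.mono_set hxyab)]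
    ring
  rw [edist_dist, edist_dist]
  refine ENNReal.ofReal_le_ofReal ?_
  rw [dist_add_left, dist_eq_norm, e1, Real.dist_eq, e2]
  exact (norm_integral_le_integral_norm _).trans (le_abs_self _)

theorem tendsto_primitive_left (hab : a < b) {g : ℝ → 𝕜} (hg : IntegrableOn g (Ioo a b) ν) :
    Tendsto (primitive a ν g) (𝓝[>] a) (𝓝 0) := by
  have h : Tendsto (fun x => ∫ y in Ioo a b, (Iic x).indicator g y ∂ν) (𝓝[>] a)
      (𝓝 (∫ y in Ioo a b, (0 : 𝕜) ∂ν)) := by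
    refine tendsto_integral_filter_of_dominated_convergence (fun y => ‖g y‖)
      (Eventually.of_forall fun x => hg.1.indicator measurableSet_Iic)
      (Eventually.of_forall fun x => ae_of_all _ fun y => norm_indicator_le_norm_self _ _)
      hg.norm ?_
    filter_upwards [ae_restrict_mem measurableSet_Ioo] with y hy
    refine tendsto_const_nhds.congr' ?_
    filter_upwards [Ioo_mem_nhdsGT hy.1] with x hx
    rw [indicator_of_notMem (by simpa using hx.2)]
  rw [integral_zero] at h
  refine h.congr' ?_
  filter_upwards [Ioo_mem_nhdsGT hab] with x hx
  rw [primitive_eq_indicator hx]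

theorem tendsto_primitive_right (hab : a < b) {g : ℝ → 𝕜} (hg : IntegrableOn g (Ioo a b) ν) :
    Tendsto (primitive a ν g) (𝓝[<] b) (𝓝 (∫ y in Ioo a b, g y ∂ν)) := by
  have h : Tendsto (fun x => ∫ y in Ioo a b, (Iic x).indicator g y ∂ν) (𝓝[<] b)
      (𝓝 (∫ y in Ioo a b, g y ∂ν)) := by
    refine tendsto_integral_filter_of_dominated_convergence (fun y => ‖g y‖)
      (Eventually.of_forall fun x => hg.1.indicator measurableSet_Iic)
      (Eventually.of_forall fun x => ae_of_all _ fun y => norm_indicator_le_norm_self _ _)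
      hg.norm ?_
    filter_upwards [ae_restrict_mem measurableSet_Ioo] with y hy
    refine tendsto_const_nhds.congr' ?_
    filter_upwards [Ioo_mem_nhdsLT hy.2] with x hx
    rw [indicator_of_mem (by simpa using hx.1.le)]
  refine h.congr' ?_
  filter_upwards [Ioo_mem_nhdsLT hab] with x hx
  rw [primitive_eq_indicator hx]

/-- A null set contains no interval (a, u). Thus functions that agree a.e. have the same limit at
the endpoint, which makes boundary values independent of the representative. -/
theorem frequently_nhdsGT_of_ae (hab : a < b) {p : ℝ → Prop}
    (h : ∀ᵐ x ∂volume.restrict (Ioo a b), p x) : ∃ᶠ x in 𝓝[>] a, p x := by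
  intro hn
  obtain ⟨u, hu, hsub⟩ := (mem_nhdsGT_iff_exists_Ioo_subset' hab).1 hn
  have h1 : ∀ᵐ x ∂volume.restrict (Ioo a (min u b)), False := by
    filter_upwards [ae_restrict_of_ae_restrict_of_subset
      (Ioo_subset_Ioo_right (min_le_right u b)) h, ae_restrict_mem measurableSet_Ioo] with x hx hx'
    exact hsub ⟨hx'.1, hx'.2.trans_le (min_le_left _ _)⟩ hx
  rw [eventually_false_iff_eq_bot, ae_eq_bot, Measure.restrict_eq_zero, Real.volume_Ioo,
    ENNReal.ofReal_eq_zero] at h1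
  have : a < min u b := lt_min hu hab
  linarith

theorem frequently_nhdsLT_of_ae (hab : a < b) {p : ℝ → Prop}
    (h : ∀ᵐ x ∂volume.restrict (Ioo a b), p x) : ∃ᶠ x in 𝓝[<] b, p x := by
  intro hn
  obtain ⟨u, hu, hsub⟩ := (mem_nhdsLT_iff_exists_Ioo_subset' hab).1 hn
  have h1 : ∀ᵐ x ∂volume.restrict (Ioo (max u a) b), False := by
    filter_upwards [ae_restrict_of_ae_restrict_of_subset
      (Ioo_subset_Ioo_left (le_max_right u a)) h, ae_restrict_mem measurableSet_Ioo] with x hx hx'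
    exact hsub ⟨(le_max_left _ _).trans_lt hx'.1, hx'.2⟩ hx
  rw [eventually_false_iff_eq_bot, ae_eq_bot, Measure.restrict_eq_zero, Real.volume_Ioo,
    ENNReal.ofReal_eq_zero] at h1
  have : max u a < b := max_lt hu hab
  linarith

theorem bvRep_spec {f g : ℝ → 𝕜} (hg : BoundedVariationOn g (Ioo a b))
    (h : g =ᵐ[volume.restrict (Ioo a b)] f) :
    BoundedVariationOn (bvRep a b f) (Ioo a b) ∧
      bvRep a b f =ᵐ[volume.restrict (Ioo a b)] f := by
  have h' : ∃ g : ℝ → 𝕜, BoundedVariationOn g (Ioo a b) ∧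
    g =ᵐ[volume.restrict (Ioo a b)] f := ⟨g, hg, h⟩
  rw [bvRep, dif_pos h']
  exact h'.choose_spec

/-- Bounded variation gives the chosen representative some limit at `a`. It agrees a.e. with `c`
plus the primitive, and the latter tends to zero there. -/
theorem rightLim_bvRep (hab : a < b) {f g : ℝ → 𝕜} {c : 𝕜} (hg : IntegrableOn g (Ioo a b) ν)
    (h : f =ᵐ[volume.restrict (Ioo a b)] fun x => c + primitive a ν g x) :
    Function.rightLim (bvRep a b f) a = c := by
  obtain ⟨h1, h2⟩ := bvRep_spec (boundedVariationOn_primitive hg c) h.symm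
  obtain ⟨l, hl⟩ := h1.exists_tendsto_right a
  have hs : 𝓝[Ioo a b ∩ Ioi a] a = 𝓝[>] a := by
    rw [inter_eq_left.2 (fun x hx => hx.1), nhdsWithin_Ioo_eq_nhdsGT hab]
  rw [hs] at hl
  have hc : Tendsto (fun x => c + primitive a ν g x) (𝓝[>] a) (𝓝 (c + 0)) :=
    (tendsto_primitive_left hab hg).const_add c
  rw [rightLim_eq_of_tendsto hl,
    tendsto_nhds_unique_of_frequently_eq hl hc (frequently_nhdsGT_of_ae hab (h2.trans h)),
    add_zero]

theorem leftLim_bvRep (hab : a < b) {f g : ℝ → 𝕜} {c : 𝕜} (hg : IntegrableOn g (Ioo a b) ν)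
    (h : f =ᵐ[volume.restrict (Ioo a b)] fun x => c + primitive a ν g x) :
    Function.leftLim (bvRep a b f) b = c + ∫ y in Ioo a b, g y ∂ν := by
  obtain ⟨h1, h2⟩ := bvRep_spec (boundedVariationOn_primitive hg c) h.symm
  obtain ⟨l, hl⟩ := h1.exists_tendsto_left b
  have hs : 𝓝[Ioo a b ∩ Iio b] b = 𝓝[<] b := by
    rw [inter_eq_left.2 (fun x hx => hx.2), nhdsWithin_Ioo_eq_nhdsLT hab]
  rw [hs] at hl
  have hc : Tendsto (fun x => c + primitive a ν g x) (𝓝[<] b)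
      (𝓝 (c + ∫ y in Ioo a b, g y ∂ν)) :=
    (tendsto_primitive_right hab hg).const_add c
  rw [leftLim_eq_of_tendsto hl,
    tendsto_nhds_unique_of_frequently_eq hl hc (frequently_nhdsLT_of_ae hab (h2.trans h))]

/-- Integration by parts for a function `w` of bounded variation and a Sobolev function `v`. -/
theorem integral_mul_conj_weakDeriv [SFinite ν] (hab : a < b) {w g v : ℝ → 𝕜}
    (hw : HasDistribDeriv a b ν w g) (hg : IntegrableOn g (Ioo a b) ν) (hv : MemW12 a b v) :
    ∫ x in Ioo a b, w x * (starRingEnd 𝕜) (weakDeriv a b v x) =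
      Function.leftLim (bvRep a b w) b * (starRingEnd 𝕜) (v b)
        - Function.rightLim (bvRep a b w) a * (starRingEnd 𝕜) (v a)
        - ∫ x in Ioo a b, g x * (starRingEnd 𝕜) (v x) ∂ν := by
  -- With `w` written as a constant plus a primitive, Fubini produces the integrals of conj(v') over
  -- (y, b); their values conj(v b) - conj(v y) supply the boundary terms and the integral against
  -- `ν`.
  obtain ⟨c, hc⟩ := hw.ae_eq_primitive hab hg
  rw [rightLim_bvRep hab hg hc, leftLim_bvRep hab hg hc]
  have hk : IntegrableOn (fun x => (starRingEnd 𝕜) (weakDeriv a b v x)) (Ioo a b) volume :=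
    (RCLike.conjCLE (K := 𝕜)).toContinuousLinearMap.integrable_comp hv.integrableOn_weakDeriv
  have e1 : ∫ x in Ioo a b, w x * (starRingEnd 𝕜) (weakDeriv a b v x) =
      ∫ x in Ioo a b, (c * (starRingEnd 𝕜) (weakDeriv a b v x)
        + (starRingEnd 𝕜) (weakDeriv a b v x) * primitive a ν g x) := by
    refine integral_congr_ae ?_
    filter_upwards [hc] with x hx
    rw [hx]
    ring
  have e2 : ∀ y ∈ Icc a b, ∫ x in Ioo y b, (starRingEnd 𝕜) (weakDeriv a b v x) =
      (starRingEnd 𝕜) (v b) - (starRingEnd 𝕜) (v y) := fun y hy => by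
    rw [integral_conj, hv.integral_weakDeriv hab hy (right_mem_Icc.2 hab.le) hy.2, map_sub]
  have hgv : IntegrableOn (fun x => g x * (starRingEnd 𝕜) (v x)) (Ioo a b) ν := by
    obtain ⟨C, hC⟩ := isCompact_Icc.exists_bound_of_continuousOn hv.1
    refine Integrable.mul_bdd (c := C) hg ?_ ?_
    · exact (RCLike.continuous_conj.comp_continuousOn
        (hv.1.mono Ioo_subset_Icc_self)).aestronglyMeasurable measurableSet_Ioo
    · filter_upwards [ae_restrict_mem measurableSet_Ioo] with x hx
      rw [RCLike.norm_conj]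
      exact hC x (Ioo_subset_Icc_self hx)
  have e3 : ∫ y in Ioo a b, (∫ x in Ioo y b, (starRingEnd 𝕜) (weakDeriv a b v x)) * g y ∂ν =
      ∫ y in Ioo a b, ((starRingEnd 𝕜) (v b) * g y - g y * (starRingEnd 𝕜) (v y)) ∂ν := by
    refine setIntegral_congr_fun measurableSet_Ioo fun y hy => ?_
    rw [e2 y (Ioo_subset_Icc_self hy)]
    ring
  rw [e1, integral_add (hk.const_mul c) (integrableOn_mul_primitive hk hg), integral_const_mul,
    e2 a (left_mem_Icc.2 hab.le), integral_mul_primitive hk hg, e3,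
    integral_sub (hg.const_mul _) hgv, integral_const_mul]
  ring

end Sobolev

/-! ## Sobolev functions that are affine off the support of a measure -/

section Interpolation

variable {𝕜 : Type*} [RCLike 𝕜] {a b : ℝ} {μ : Measure ℝ}

theorem setIntegral_Ioc_restrict_eq_primitive (k : ℝ → 𝕜) {x : ℝ} (hx : x ∈ Icc a b) :
    ∫ t in Ioc a x, k t ∂(volume.restrict (Ioo a b)) = primitive a volume k x := by
  rw [Measure.restrict_congr_set Ioo_ae_eq_Ioc, Measure.restrict_restrict measurableSet_Ioc,
    inter_eq_left.2 (Ioc_subset_Ioc_right hx.2), primitive]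

/-- The derivative of the interpolant is the orthogonal projection of the given derivative onto
the closed span of the indicator functions of the intervals `(a, x]` with `x ∈ S`. -/
theorem exists_interpolating_density {S : Set ℝ} (hS : S ⊆ Icc a b) {k : ℝ → 𝕜}
    (hk : MemLp k 2 (volume.restrict (Ioo a b))) :
    ∃ k' : ℝ → 𝕜, MemLp k' 2 (volume.restrict (Ioo a b)) ∧
      (∀ x ∈ S, primitive a volume k' x = primitive a volume k x) ∧
      ∀ h : ℝ → 𝕜, MemLp h 2 (volume.restrict (Ioo a b)) →
        (∀ x ∈ S, primitive a volume h x = 0) →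
        ∫ x in Ioo a b, k' x * (starRingEnd 𝕜) (h x) = 0 := by
  let I : S → Lp 𝕜 2 (volume.restrict (Ioo a b)) := fun x =>
    indicatorConstLp 2 (measurableSet_Ioc : MeasurableSet (Ioc a x.1)) (measure_ne_top _ _) 1
  let N : Submodule 𝕜 (Lp 𝕜 2 (volume.restrict (Ioo a b))) :=
    (Submodule.span 𝕜 (range I)).topologicalClosure
  -- Pairing with the indicator of (a, x] evaluates the primitive at `x`. So orthogonality to `N`
  -- means that the primitive vanishes on `S`, and projecting onto `N` keeps its values there.
  have hI : ∀ (x : S) (f : Lp 𝕜 2 (volume.restrict (Ioo a b))),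
      inner 𝕜 (I x) f = primitive a volume f x.1 := fun x f => by
    rw [L2.inner_indicatorConstLp_one, setIntegral_Ioc_restrict_eq_primitive _ (hS x.2)]
  have hIN : ∀ x, I x ∈ N := fun x =>
    Submodule.le_topologicalClosure _ (Submodule.subset_span ⟨x, rfl⟩)
  have hmem : ∀ f : Lp 𝕜 2 (volume.restrict (Ioo a b)),
      (∀ x ∈ S, primitive a volume f x = 0) → f ∈ Nᗮ := fun f hf => by
    rw [Submodule.orthogonal_closure, Submodule.mem_orthogonal]
    intro u hu
    induction hu using Submodule.span_induction with
    | mem y hy =>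
      obtain ⟨x, rfl⟩ := hy
      rw [hI, hf x.1 x.2]
    | zero => exact inner_zero_left _
    | add y z _ _ hy hz => rw [inner_add_left, hy, hz, add_zero]
    | smul r y _ hy => rw [inner_smul_left, hy, mul_zero]
  set κ := hk.toLp k with hκ
  refine ⟨N.starProjection κ, Lp.memLp _, fun x hx => ?_, fun h hh hx => ?_⟩
  · have h1 : inner 𝕜 (I ⟨x, hx⟩) (κ - N.starProjection κ) = 0 :=
      (Submodule.mem_orthogonal _ _).1 (N.sub_starProjection_mem_orthogonal κ) _ (hIN _)
    rw [inner_sub_right, hI, hI, sub_eq_zero] at h1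
    rw [← h1]
    exact primitive_congr hk.coeFn_toLp (hS hx)
  · have h1 : hh.toLp h ∈ Nᗮ := hmem _ fun x hxS => by
      rw [primitive_congr hh.coeFn_toLp (hS hxS), hx x hxS]
    have h2 : inner 𝕜 (hh.toLp h) (N.starProjection κ) = 0 :=
      (Submodule.mem_orthogonal' _ _).1 h1 _ (N.starProjection_apply_mem κ)
    rw [← h2, L2.inner_def]
    refine integral_congr_ae ?_
    filter_upwards [hh.coeFn_toLp] with x hx
    rw [hx, RCLike.inner_apply]

/-- The admissible test density is `k` minus its mean `m` over the gap, extended by zero: its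
primitive vanishes outside the gap. Orthogonality of `k` and of the constant `m` to it gives ∫ |k -
m|² = 0 over the gap. -/
theorem ae_eq_const_on_gap {S : Set ℝ} {k : ℝ → 𝕜}
    (hk : MemLp k 2 (volume.restrict (Ioo a b)))
    (horth : ∀ h : ℝ → 𝕜, MemLp h 2 (volume.restrict (Ioo a b)) →
      (∀ x ∈ S, primitive a volume h x = 0) →
      ∫ x in Ioo a b, k x * (starRingEnd 𝕜) (h x) = 0)
    {c d : ℝ} (hac : a ≤ c) (hcd : c < d) (hdb : d ≤ b) (hgap : ∀ x ∈ S, x ≤ c ∨ d ≤ x) :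
    ∃ m : 𝕜, k =ᵐ[volume.restrict (Ioo c d)] fun _ => m := by
  have hsub : Ioo c d ⊆ Ioo a b := Ioo_subset_Ioo hac hdb
  have hkcd : MemLp k 2 (volume.restrict (Ioo c d)) :=
    hk.mono_measure (Measure.restrict_mono hsub le_rfl)
  set m : 𝕜 := ((d - c : ℝ) : 𝕜)⁻¹ * ∫ x in Ioo c d, k x with hm
  have hdc : ((d - c : ℝ) : 𝕜) ≠ 0 := by
    rw [Ne, RCLike.ofReal_eq_zero]
    linarith
  have hdiff : MemLp (fun x => k x - m) 2 (volume.restrict (Ioo c d)) := hkcd.sub (memLp_const m)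
  have hmean : ∫ x in Ioo c d, (k x - m) = 0 := by
    rw [integral_sub (integrableOn_of_memLp_two hkcd) (integrable_const m), integral_const,
      measureReal_restrict_apply_univ, Real.volume_real_Ioo_of_le hcd.le,
      RCLike.real_smul_eq_coe_mul, hm, mul_inv_cancel_left₀ hdc, sub_self]
  have hh : MemLp ((Ioo c d).indicator fun x => k x - m) 2 (volume.restrict (Ioo a b)) :=
    (hk.sub (memLp_const m)).indicator measurableSet_Ioo
  have h0 := horth _ hh fun x hx => by
    rw [primitive, setIntegral_indicator measurableSet_Ioo]
    rcases hgap x hx with h | h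
    · rw [(by ext t; simp only [mem_inter_iff, mem_Ioc, mem_Ioo, mem_empty_iff_false, iff_false]
              rintro ⟨h1, h2⟩; linarith [h1.2, h2.1] : Ioc a x ∩ Ioo c d = ∅)]
      simp
    · rw [inter_eq_right.2 (Ioo_subset_Ioc_self.trans (Ioc_subset_Ioc hac h)), hmean]
  have h1 : ∫ x in Ioo c d, k x * (starRingEnd 𝕜) (k x - m) = 0 := by
    rw [← h0]
    have : ∀ x, k x * (starRingEnd 𝕜) ((Ioo c d).indicator (fun x => k x - m) x) =
        (Ioo c d).indicator (fun x => k x * (starRingEnd 𝕜) (k x - m)) x := fun x => by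
      by_cases hx : x ∈ Ioo c d
      · simp only [indicator_of_mem hx]
      · simp only [indicator_of_notMem hx, map_zero, mul_zero]
    simp only [this]
    rw [setIntegral_indicator measurableSet_Ioo, inter_eq_right.2 hsub]
  have h2 : ∫ x in Ioo c d, m * (starRingEnd 𝕜) (k x - m) = 0 := by
    rw [integral_const_mul, integral_conj, hmean, map_zero, mul_zero]
  have hconj : MemLp (fun x => (starRingEnd 𝕜) (k x - m)) 2 (volume.restrict (Ioo c d)) :=
    hdiff.star
  have i1 : Integrable (fun x => k x * (starRingEnd 𝕜) (k x - m)) (volume.restrict (Ioo c d)) :=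
    hkcd.integrable_mul hconj
  have i2 : Integrable (fun x => m * (starRingEnd 𝕜) (k x - m)) (volume.restrict (Ioo c d)) :=
    (integrableOn_of_memLp_two hconj).const_mul m
  have h3 : ∫ x in Ioo c d, ((‖k x - m‖ ^ 2 : ℝ) : 𝕜) = 0 := by
    rw [← sub_eq_zero.2 (h1.trans h2.symm), ← integral_sub i1 i2]
    refine integral_congr_ae (ae_of_all _ fun x => ?_)
    simp only
    rw [← sub_mul, RCLike.mul_conj]
    push_cast
    rfl
  rw [integral_ofReal, RCLike.ofReal_eq_zero, integral_eq_zero_iff_of_nonneg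
    (fun x => sq_nonneg _) ((memLp_two_iff_integrable_sq_norm hdiff.1).1 hdiff)] at h3
  refine ⟨m, ?_⟩
  filter_upwards [h3] with x hx
  exact sub_eq_zero.1 (norm_eq_zero.1 (pow_eq_zero_iff two_ne_zero |>.1 hx))

/-! ### Gaps of the support and linear interpolation -/

/-- The standing assumptions on the measure of an edge that carries mass. -/
structure IsEdgeMeasure (a b : ℝ) (μ : Measure ℝ) : Prop where
  lt : a < b
  finite : IsFiniteMeasure μ
  compl : μ (Icc a b)ᶜ = 0
  left_mem : a ∈ μ.support
  right_mem : b ∈ μ.support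
  endpoints : μ {a, b} = 0

namespace IsEdgeMeasure

variable (hμ : IsEdgeMeasure a b μ)

include hμ

theorem left_mem_Icc : a ∈ Icc a b := ⟨le_rfl, hμ.lt.le⟩

theorem right_mem_Icc : b ∈ Icc a b := ⟨hμ.lt.le, le_rfl⟩

theorem restrict_Ioo : μ.restrict (Ioo a b) = μ := by
  refine Measure.restrict_eq_self_of_ae_mem ?_
  rw [ae_iff]
  refine measure_mono_null (fun x hx => ?_) (measure_union_null hμ.compl hμ.endpoints)
  by_cases h : x ∈ Icc a b
  · right
    rcases eq_or_lt_of_le h.1 with h1 | h1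
    · simp [h1]
    · rcases eq_or_lt_of_le h.2 with h2 | h2
      · simp [h2]
      · exact absurd ⟨h1, h2⟩ hx
  · exact Or.inl h

theorem support_subset : μ.support ⊆ Icc a b :=
  Measure.support_subset_of_isClosed isClosed_Icc (mem_ae_iff.2 hμ.compl)

/-- If the functions differ at a support point, they differ on a relative neighbourhood of it, which
has positive measure. -/
theorem eq_of_ae_eq {f g : ℝ → 𝕜} (hf : ContinuousOn f (Icc a b)) (hg : ContinuousOn g (Icc a b))
    (h : f =ᵐ[μ] g) : EqOn f g μ.support := by
  intro x hx
  by_contra hne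
  have hxI := hμ.support_subset hx
  have h1 : ∀ᶠ y in 𝓝[Icc a b] x, f y ≠ g y := by
    have h2 := ((hf x hxI).sub (hg x hxI)).eventually_ne (sub_ne_zero.2 hne)
    exact h2.mono fun y hy => sub_ne_zero.1 hy
  rw [eventually_nhdsWithin_iff] at h1
  refine ((Measure.mem_support_iff_forall x).1 hx _ h1).ne' ?_
  refine measure_mono_null (fun y hy => ?_) (measure_union_null hμ.compl (ae_iff.1 h))
  by_cases hyI : y ∈ Icc a b
  · exact Or.inr (hy hyI)
  · exact Or.inl hyI

omit hμ in
theorem ae_eq_of_eqOn {F : Type*} {f g : ℝ → F} (h : EqOn f g μ.support) : f =ᵐ[μ] g := by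
  filter_upwards [Measure.support_mem_ae (μ := μ)] with x hx
  exact h hx

/-- A point off the support lies in a gap of the support. -/
theorem exists_gap {x : ℝ} (hx : x ∈ Icc a b \ μ.support) :
    ∃ c d, c ∈ μ.support ∧ d ∈ μ.support ∧ c < x ∧ x < d ∧
      Disjoint (Ioo c d) μ.support := by
  have hcl : IsClosed μ.support := Measure.isClosed_support
  -- The nearest support points on either side of `x` exist because the support is closed and
  -- contains both `a` and `b`.
  obtain ⟨c, ⟨hcS, hcI⟩, hc⟩ := (isCompact_Icc.inter_left hcl : IsCompact (μ.support ∩ Icc a x))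
    |>.exists_isGreatest ⟨a, hμ.left_mem, le_rfl, hx.1.1⟩
  obtain ⟨d, ⟨hdS, hdI⟩, hd⟩ := (isCompact_Icc.inter_left hcl : IsCompact (μ.support ∩ Icc x b))
    |>.exists_isLeast ⟨b, hμ.right_mem, hx.1.2, le_rfl⟩
  refine ⟨c, d, hcS, hdS, lt_of_le_of_ne hcI.2 (fun h => hx.2 (h ▸ hcS)),
    lt_of_le_of_ne hdI.1 (fun h => hx.2 (h ▸ hdS)), ?_⟩
  rw [disjoint_left]
  intro y hy hyS
  have hyI := hμ.support_subset hyS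
  rcases le_total y x with h | h
  · exact absurd (hc ⟨hyS, hyI.1, h⟩) (not_le.2 hy.1)
  · exact absurd (hd ⟨hyS, h, hyI.2⟩) (not_le.2 hy.2)

theorem connectedComponentIn_eq {x c d : ℝ} (hx : x ∈ Icc a b \ μ.support) (hc : c ∈ μ.support)
    (hd : d ∈ μ.support) (hcx : c < x) (hxd : x < d) (hdisj : Disjoint (Ioo c d) μ.support) :
    connectedComponentIn (Icc a b \ μ.support) x = Ioo c d := by
  refine Subset.antisymm (fun y hy => ?_) ?_
  · have hoc : OrdConnected (connectedComponentIn (Icc a b \ μ.support) x) :=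
      isPreconnected_connectedComponentIn.ordConnected
    have hxm := mem_connectedComponentIn hx
    have hsub := connectedComponentIn_subset (Icc a b \ μ.support) x
    constructor
    · by_contra h
      exact (hsub (hoc.out hy hxm ⟨not_lt.1 h, hcx.le⟩)).2 hc
    · by_contra h
      exact (hsub (hoc.out hxm hy ⟨hxd.le, not_lt.1 h⟩)).2 hd
  · refine isPreconnected_Ioo.subset_connectedComponentIn ⟨hcx, hxd⟩ fun y hy => ⟨?_, ?_⟩
    · exact ⟨(hμ.support_subset hc).1.trans hy.1.le, hy.2.le.trans (hμ.support_subset hd).2⟩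
    · exact disjoint_left.1 hdisj hy

/-- On a gap both functions are affine, by continuity up to its endpoints. These lie in the support,
and two values determine an affine function. -/
theorem eqOn_of_eqOn_support {f g : ℝ → 𝕜} (hf : MemW12mu a b μ f) (hg : MemW12mu a b μ g)
    (h : EqOn f g μ.support) : EqOn f g (Icc a b) := by
  intro x hx
  by_cases hxS : x ∈ μ.support
  · exact h hxS
  obtain ⟨c, d, hc, hd, hcx, hxd, hdisj⟩ := hμ.exists_gap ⟨hx, hxS⟩
  have hcomp := hμ.connectedComponentIn_eq ⟨hx, hxS⟩ hc hd hcx hxd hdisj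
  have hcd : c < d := hcx.trans hxd
  have hsub : Icc c d ⊆ Icc a b :=
    Icc_subset_Icc (hμ.support_subset hc).1 (hμ.support_subset hd).2
  have haff : ∀ {u : ℝ → 𝕜}, MemW12mu a b μ u → ∃ α β : 𝕜, ∀ y ∈ Icc c d, u y = α + β * y := by
    intro u hu
    obtain ⟨α, β, hαβ⟩ := hu.2 x ⟨hx, hxS⟩
    rw [hcomp] at hαβ
    refine ⟨α, β, eqOn_Icc_of_ae_eq_Ioo hcd (hu.1.1.mono hsub) (by fun_prop) ?_⟩
    filter_upwards [ae_restrict_mem measurableSet_Ioo] with y hy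
    exact hαβ y hy
  obtain ⟨α, β, hu⟩ := haff hf
  obtain ⟨α', β', hv⟩ := haff hg
  have e1 : α + β * c = α' + β' * c := by
    rw [← hu c ⟨le_rfl, hcd.le⟩, ← hv c ⟨le_rfl, hcd.le⟩, h hc]
  have e2 : α + β * d = α' + β' * d := by
    rw [← hu d ⟨hcd.le, le_rfl⟩, ← hv d ⟨hcd.le, le_rfl⟩, h hd]
  have hne : ((d : ℝ) : 𝕜) - c ≠ 0 := by
    rw [← RCLike.ofReal_sub, Ne, RCLike.ofReal_eq_zero]
    linarith
  have hβ : β = β' := by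
    refine mul_right_cancel₀ hne ?_
    linear_combination e2 - e1
  have hα : α = α' := by
    rw [hβ] at e1
    exact add_right_cancel e1
  rw [hu x ⟨hcx.le, hxd.le⟩, hv x ⟨hcx.le, hxd.le⟩, hα, hβ]

/-- Every Sobolev function can be replaced by its linear interpolation in the gaps of the support.
The derivative of the interpolant is orthogonal to all densities whose primitive vanishes on the
support. -/
theorem exists_memW12mu {g : ℝ → 𝕜} (hg : MemW12 a b g) :
    ∃ u : ℝ → 𝕜, MemW12mu a b μ u ∧ EqOn u g μ.support ∧
      ∀ h : ℝ → 𝕜, MemLp h 2 (volume.restrict (Ioo a b)) →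
        (∀ x ∈ μ.support, primitive a volume h x = 0) →
        ∫ x in Ioo a b, weakDeriv a b u x * (starRingEnd 𝕜) (h x) = 0 := by
  obtain ⟨k, hk, hkS, horth⟩ :=
    exists_interpolating_density hμ.support_subset hg.memLp_weakDeriv
  have hki := integrableOn_of_memLp_two hk
  refine ⟨fun x => g a + primitive a volume k x, ⟨memW12_primitive hk _, fun x hx => ?_⟩,
    fun x hx => ?_, fun h hh hS => ?_⟩
  · obtain ⟨c, d, hc, hd, hcx, hxd, hdisj⟩ := hμ.exists_gap hx
    rw [hμ.connectedComponentIn_eq hx hc hd hcx hxd hdisj]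
    have hcI := hμ.support_subset hc
    have hdI := hμ.support_subset hd
    obtain ⟨m, hm⟩ := ae_eq_const_on_gap hk horth hcI.1 (hcx.trans hxd) hdI.2 fun y hy => by
      by_contra! hcon
      exact disjoint_left.1 hdisj hcon hy
    refine ⟨g a + primitive a volume k c - m * c, m, fun y hy => ?_⟩
    have e := integral_Ioo_eq_primitive_sub hki hcI
      (⟨hcI.1.trans hy.1.le, hy.2.le.trans hdI.2⟩ : y ∈ Icc a b) hy.1.le
    have e' : ∫ t in Ioo c y, k t = m * ((y : 𝕜) - c) := by
      rw [integral_congr_ae (ae_restrict_of_ae_restrict_of_subset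
        (Ioo_subset_Ioo_right hy.2.le) hm), integral_const, measureReal_restrict_apply_univ,
        Real.volume_real_Ioo_of_le hy.1.le, RCLike.real_smul_eq_coe_mul]
      push_cast
      ring
    linear_combination e' - e
  · simp only
    rw [hkS x hx]
    exact (hg.eq_primitive hμ.lt (hμ.support_subset hx)).symm
  · rw [← horth h hh hS]
    refine integral_congr_ae ?_
    filter_upwards [(hasDistribDeriv_primitive hki (g a)).weakDeriv_ae_eq] with x hx
    rw [hx]

/-- The density of `v - v'` has a primitive vanishing on the support, hence is orthogonal to the
derivative of any interpolant. -/
theorem integral_weakDeriv_congr {u v v' : ℝ → 𝕜} (hu : MemW12mu a b μ u) (hv : MemW12 a b v)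
    (hv' : MemW12 a b v') (h : EqOn v v' μ.support) :
    ∫ x in Ioo a b, weakDeriv a b u x * (starRingEnd 𝕜) (weakDeriv a b v x) =
      ∫ x in Ioo a b, weakDeriv a b u x * (starRingEnd 𝕜) (weakDeriv a b v' x) := by
  -- By uniqueness the interpolant `w` of `u` is `u` itself, so the orthogonality passes to `u`.
  obtain ⟨w, hw, hwu, horth⟩ := hμ.exists_memW12mu hu.1
  have hwu' := hμ.eqOn_of_eqOn_support hw hu hwu
  have h0 := horth (fun x => weakDeriv a b v x - weakDeriv a b v' x)
    (hv.memLp_weakDeriv.sub hv'.memLp_weakDeriv) fun x hx => by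
      have hxI := hμ.support_subset hx
      have e1 := hv.eq_primitive hμ.lt hxI
      have e2 := hv'.eq_primitive hμ.lt hxI
      have i1 := hv.integrableOn_weakDeriv.mono_set (Ioo_subset_Ioo_right hxI.2)
      have i2 := hv'.integrableOn_weakDeriv.mono_set (Ioo_subset_Ioo_right hxI.2)
      have e3 : primitive a volume (fun x => weakDeriv a b v x - weakDeriv a b v' x) x =
          primitive a volume (weakDeriv a b v) x - primitive a volume (weakDeriv a b v') x := by
        simp only [primitive, integral_Ioc_eq_integral_Ioo]
        exact integral_sub i1 i2
      simp only at e1 e2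
      rw [e3]
      linear_combination -e1 + e2 + h hx - h hμ.left_mem
  have i1 : Integrable (fun x => weakDeriv a b u x * (starRingEnd 𝕜) (weakDeriv a b v x))
      (volume.restrict (Ioo a b)) :=
    hu.1.memLp_weakDeriv.integrable_mul hv.memLp_weakDeriv.star
  have i2 : Integrable (fun x => weakDeriv a b u x * (starRingEnd 𝕜) (weakDeriv a b v' x))
      (volume.restrict (Ioo a b)) :=
    hu.1.memLp_weakDeriv.integrable_mul hv'.memLp_weakDeriv.star
  rw [← sub_eq_zero, ← integral_sub i1 i2, ← h0]
  refine integral_congr_ae ?_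
  filter_upwards [weakDeriv_ae_eq_of_eqOn hw.1 hwu'] with x hx
  rw [hx, map_sub]
  ring

/-! ### The map ι on one edge -/

theorem iota_spec {f : Lp 𝕜 2 μ} (hf : f ∈ iotaDomain 𝕜 a b μ) :
    MemW12mu a b μ (iota a b μ f) ∧ iota a b μ f =ᵐ[μ] f := by
  obtain ⟨g, hg, hgf⟩ := hf
  obtain ⟨u, hu, hug, -⟩ := hμ.exists_memW12mu hg
  have h : ∃ g : ℝ → 𝕜, MemW12mu a b μ g ∧ g =ᵐ[μ] f := ⟨u, hu, (ae_eq_of_eqOn hug).trans hgf⟩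
  rw [iota, dif_pos h]
  exact h.choose_spec

theorem eqOn_iota {f : Lp 𝕜 2 μ} {g : ℝ → 𝕜} (hg : MemW12mu a b μ g) (h : g =ᵐ[μ] f) :
    EqOn (iota a b μ f) g (Icc a b) := by
  obtain ⟨h1, h2⟩ := hμ.iota_spec ⟨g, hg.1, h⟩
  exact hμ.eqOn_of_eqOn_support h1 hg (hμ.eq_of_ae_eq h1.1.1 hg.1.1 (h2.trans h.symm))

theorem exists_iota {v : ℝ → 𝕜} (hv : MemW12 a b v) :
    ∃ f : Lp 𝕜 2 μ, f =ᵐ[μ] v ∧ f ∈ iotaDomain 𝕜 a b μ ∧ EqOn (iota a b μ f) v μ.support := by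
  have := hμ.finite
  have hv2 : MemLp v 2 μ := by
    have h := memLp_of_continuousOn (ν := μ) hv.1
    rwa [hμ.restrict_Ioo] at h
  have hf : hv2.toLp v ∈ iotaDomain 𝕜 a b μ := ⟨v, hv, hv2.coeFn_toLp.symm⟩
  obtain ⟨h1, h2⟩ := hμ.iota_spec hf
  exact ⟨hv2.toLp v, hv2.coeFn_toLp, hf, hμ.eq_of_ae_eq h1.1.1 hv.1 (h2.trans hv2.coeFn_toLp)⟩

theorem iota_add {f g : Lp 𝕜 2 μ} (hf : f ∈ iotaDomain 𝕜 a b μ) (hg : g ∈ iotaDomain 𝕜 a b μ) :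
    f + g ∈ iotaDomain 𝕜 a b μ ∧
      EqOn (iota a b μ (f + g)) (fun x => iota a b μ f x + iota a b μ g x) (Icc a b) := by
  obtain ⟨h1, h2⟩ := hμ.iota_spec hf
  obtain ⟨h1', h2'⟩ := hμ.iota_spec hg
  have hm : MemW12mu a b μ (fun x => iota a b μ f x + iota a b μ g x) := by
    refine ⟨h1.1.add h1'.1, fun x hx => ?_⟩
    obtain ⟨α, β, h⟩ := h1.2 x hx
    obtain ⟨α', β', h'⟩ := h1'.2 x hx
    refine ⟨α + α', β + β', fun y hy => ?_⟩
    simp only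
    rw [h y hy, h' y hy]
    ring
  have hae : (fun x => iota a b μ f x + iota a b μ g x) =ᵐ[μ] ⇑(f + g) := by
    filter_upwards [h2, h2', Lp.coeFn_add f g] with x e1 e2 e3
    rw [e3, Pi.add_apply, e1, e2]
  exact ⟨⟨_, hm.1, hae⟩, hμ.eqOn_iota hm hae⟩

theorem iota_smul {f : Lp 𝕜 2 μ} (hf : f ∈ iotaDomain 𝕜 a b μ) (r : 𝕜) :
    r • f ∈ iotaDomain 𝕜 a b μ ∧
      EqOn (iota a b μ (r • f)) (fun x => r * iota a b μ f x) (Icc a b) := by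
  obtain ⟨h1, h2⟩ := hμ.iota_spec hf
  have hm : MemW12mu a b μ (fun x => r * iota a b μ f x) := by
    refine ⟨h1.1.const_mul r, fun x hx => ?_⟩
    obtain ⟨α, β, h⟩ := h1.2 x hx
    refine ⟨r * α, r * β, fun y hy => ?_⟩
    simp only
    rw [h y hy]
    ring
  have hae : (fun x => r * iota a b μ f x) =ᵐ[μ] ⇑(r • f) := by
    filter_upwards [h2, Lp.coeFn_smul r f] with x e1 e2
    rw [e2, Pi.smul_apply, e1, smul_eq_mul]
  exact ⟨⟨_, hm.1, hae⟩, hμ.eqOn_iota hm hae⟩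

/-- There are elements of the domain of `iota` with prescribed boundary values. -/
theorem exists_boundary_values (α β : 𝕜) : ∃ f : Lp 𝕜 2 μ, f ∈ iotaDomain 𝕜 a b μ ∧
    iota a b μ f a = α ∧ iota a b μ f b = β := by
  have hne : ((b - a : ℝ) : 𝕜) ≠ 0 := by
    rw [Ne, RCLike.ofReal_eq_zero]
    linarith [hμ.lt]
  -- The affine function from α to β; its endpoint values survive the passage through ι because `a`
  -- and `b` belong to the support.
  obtain ⟨f, -, hf, h⟩ := hμ.exists_iota
    (memW12_primitive (memLp_const (((b - a : ℝ) : 𝕜)⁻¹ * (β - α))) α)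
  refine ⟨f, hf, ?_, ?_⟩
  · rw [h hμ.left_mem]
    simp only
    rw [primitive_left, add_zero]
  · rw [h hμ.right_mem]
    simp only
    rw [primitive, integral_const, measureReal_restrict_apply_univ,
      Real.volume_real_Ioc_of_le hμ.lt.le, RCLike.real_smul_eq_coe_mul, mul_inv_cancel_left₀ hne]
    ring

theorem iota_zero : (0 : Lp 𝕜 2 μ) ∈ iotaDomain 𝕜 a b μ ∧
    EqOn (iota a b μ (0 : Lp 𝕜 2 μ)) (fun _ => 0) (Icc a b) := by
  obtain ⟨f, hf, -⟩ := hμ.exists_boundary_values (0 : 𝕜) 0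
  have h := hμ.iota_smul hf 0
  simpa only [zero_smul, zero_mul] using h

omit hμ in
theorem memW12_ofReal_test {φ : ℝ → ℝ} (hφ : ContDiff ℝ ∞ φ)
    (hφs : tsupport φ ⊆ Ioo a b) :
    MemW12 a b (fun x => (φ x : 𝕜)) ∧
      weakDeriv a b (fun x => (φ x : 𝕜)) =ᵐ[volume.restrict (Ioo a b)]
        fun x => ((deriv φ x : ℝ) : 𝕜) := by
  have hd := (contDiff_infty_iff_deriv.1 hφ).2.continuous
  have hk : MemLp (fun x => ((deriv φ x : ℝ) : 𝕜)) 2 (volume.restrict (Ioo a b)) :=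
    memLp_of_continuousOn (RCLike.continuous_ofReal.comp hd).continuousOn
  have he : EqOn (fun x => 0 + primitive a volume (fun x => ((deriv φ x : ℝ) : 𝕜)) x)
      (fun x => (φ x : 𝕜)) (Icc a b) := fun x hx => by
    simp only
    rw [primitive, integral_ofReal, ← intervalIntegral.integral_of_le hx.1,
      intervalIntegral.integral_deriv_eq_sub
        (fun x _ => (contDiff_infty_iff_deriv.1 hφ).1 x) (hd.intervalIntegrable _ _),
      image_eq_zero_of_notMem_tsupport fun h => lt_irrefl a (hφs h).1, sub_zero, zero_add]
  refine ⟨(memW12_primitive hk 0).congr he, ?_⟩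
  exact (weakDeriv_ae_eq_of_eqOn (memW12_primitive hk 0) he).symm.trans
    (hasDistribDeriv_primitive (integrableOn_of_memLp_two hk) 0).weakDeriv_ae_eq

/-- The weak form of the equation `-∂_μ (ι f)' = h`. -/
theorem hasMuDeriv_of_forall_test {f h : Lp 𝕜 2 μ} (hf : f ∈ iotaDomain 𝕜 a b μ)
    (H : ∀ g ∈ iotaDomain 𝕜 a b μ, iota a b μ g a = 0 → iota a b μ g b = 0 →
      ∫ x in Ioo a b, weakDeriv a b (iota a b μ f) x *
        (starRingEnd 𝕜) (weakDeriv a b (iota a b μ g) x) = inner 𝕜 g h) :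
    HasMuDeriv a b μ (weakDeriv a b (iota a b μ f)) (fun x => - h x) := by
  have := hμ.finite
  have hu := (hμ.iota_spec hf).1
  have hint : Integrable (fun x => - h x) μ := ((Lp.memLp h).integrable one_le_two).neg
  refine ⟨hint, hu.1.integrableOn_weakDeriv.locallyIntegrableOn,
    hint.integrableOn.locallyIntegrableOn, fun φ h1 h2 h3 => ?_⟩
  obtain ⟨hv, hvd⟩ := memW12_ofReal_test (𝕜 := 𝕜) h1 h3
  obtain ⟨g, hgφ, hg, hgS⟩ := hμ.exists_iota hv
  have e0 : ∀ x, x ∉ Ioo a b → φ x = 0 := fun x hx =>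
    image_eq_zero_of_notMem_tsupport fun h => hx (h3 h)
  have e := H g hg ((hgS hμ.left_mem).trans (by simp [e0 a (by simp)]))
    ((hgS hμ.right_mem).trans (by simp [e0 b (by simp)]))
  -- `iota a b μ g` and φ are known to agree on the support only, but the integral against (ι f)'
  -- does not see the difference.
  rw [hμ.integral_weakDeriv_congr hu (hμ.iota_spec hg).1.1 hv hgS, L2.inner_def] at e
  rw [hμ.restrict_Ioo]
  have e1 : ∫ x in Ioo a b, deriv φ x • weakDeriv a b (iota a b μ f) x =
      ∫ x in Ioo a b, weakDeriv a b (iota a b μ f) x *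
        (starRingEnd 𝕜) (weakDeriv a b (fun x => (φ x : 𝕜)) x) := by
    refine integral_congr_ae ?_
    filter_upwards [hvd] with x hx
    rw [hx, RCLike.conj_ofReal, RCLike.real_smul_eq_coe_mul, mul_comm]
  rw [e1, e, ← integral_neg]
  refine integral_congr_ae ?_
  filter_upwards [hgφ] with x hx
  rw [hx, RCLike.inner_apply, RCLike.conj_ofReal, RCLike.real_smul_eq_coe_mul]
  ring

end IsEdgeMeasure

end Interpolation

/-! ## The operator on the graph -/

theorem WSpace.inner_eq {𝕜 : Type*} [RCLike 𝕜] {ι : Type*} [Fintype ι] (w : ι → Set.Ioi (0 : ℝ))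
    (x y : WSpace 𝕜 w) :
    inner 𝕜 x y = ∑ i, y i * (starRingEnd 𝕜) (x i) * ((w i : ℝ) : 𝕜) := rfl

theorem applyOn_of_mem {𝕜 F : Type*} [RCLike 𝕜] [AddCommGroup F] [Module 𝕜 F]
    {X : Submodule 𝕜 F} (L : X →ₗ[𝕜] X) {x : F} (hx : x ∈ X) : applyOn X L x = L ⟨x, hx⟩ := by
  rw [applyOn, dif_pos hx]

theorem applyOn_add {𝕜 F : Type*} [RCLike 𝕜] [AddCommGroup F] [Module 𝕜 F]
    {X : Submodule 𝕜 F} (L : X →ₗ[𝕜] X) {x y : F} (hx : x ∈ X) (hy : y ∈ X) :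
    applyOn X L (x + y) = applyOn X L x + applyOn X L y := by
  rw [applyOn_of_mem L hx, applyOn_of_mem L hy, applyOn_of_mem L (X.add_mem hx hy),
    ← Submodule.coe_add, ← map_add]
  rfl

theorem applyOn_smul {𝕜 F : Type*} [RCLike 𝕜] [AddCommGroup F] [Module 𝕜 F]
    {X : Submodule 𝕜 F} (L : X →ₗ[𝕜] X) (r : 𝕜) {x : F} (hx : x ∈ X) :
    applyOn X L (r • x) = r • applyOn X L x := by
  rw [applyOn_of_mem L hx, applyOn_of_mem L (X.smul_mem r hx), ← Submodule.coe_smul, ← map_smul]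
  rfl

namespace MGraph

variable {𝕜 : Type*} [RCLike 𝕜] {V E : Type*} (G : MGraph V E)

theorem isEdgeMeasure (e : G.E₁) : IsEdgeMeasure (G.a e.1) (G.b e.1) (G.μ e.1) := by
  obtain ⟨h1, h2, h3⟩ := (G.μ_cases e.1).resolve_left e.2
  exact ⟨G.a_lt_b e.1, G.finite_μ e.1, G.μ_compl e.1, h1, h2, h3⟩

section Edges

variable [Finite E]

/-- The domain of `ι` on the edges. -/
def edgeDomain (𝕜 : Type*) [RCLike 𝕜] : Set (G.HE 𝕜) :=
  {f | ∀ e, f e ∈ iotaDomain 𝕜 (G.a e.1) (G.b e.1) (G.μ e.1)}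

variable {G}

theorem memW12_iotaE {f : G.HE 𝕜} (hf : f ∈ G.edgeDomain 𝕜) (e : G.E₁) :
    MemW12 (G.a e.1) (G.b e.1) (G.iotaE f e) :=
  ((G.isEdgeMeasure e).iota_spec (hf e)).1.1

theorem edgeDomain_add {f g : G.HE 𝕜} (hf : f ∈ G.edgeDomain 𝕜) (hg : g ∈ G.edgeDomain 𝕜) :
    f + g ∈ G.edgeDomain 𝕜 := fun e => ((G.isEdgeMeasure e).iota_add (hf e) (hg e)).1

theorem edgeDomain_smul {f : G.HE 𝕜} (hf : f ∈ G.edgeDomain 𝕜) (r : 𝕜) :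
    r • f ∈ G.edgeDomain 𝕜 := fun e => ((G.isEdgeMeasure e).iota_smul (hf e) r).1

/-- Both `iota` and `weakDeriv` are chosen representatives, so additivity comes from uniqueness: on
[a, b] for the former, a.e. for the latter. -/
theorem diotaE_add {f g : G.HE 𝕜} (hf : f ∈ G.edgeDomain 𝕜) (hg : g ∈ G.edgeDomain 𝕜)
    (e : G.E₁) : G.diotaE (f + g) e =ᵐ[volume.restrict (Ioo (G.a e.1) (G.b e.1))]
      fun x => G.diotaE f e x + G.diotaE g e x :=
  (weakDeriv_ae_eq_of_eqOn (memW12_iotaE (edgeDomain_add hf hg) e)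
    ((G.isEdgeMeasure e).iota_add (hf e) (hg e)).2).trans
    ((memW12_iotaE hf e).hasDistribDeriv.add (memW12_iotaE hg e).hasDistribDeriv).weakDeriv_ae_eq

theorem diotaE_smul {f : G.HE 𝕜} (hf : f ∈ G.edgeDomain 𝕜) (r : 𝕜) (e : G.E₁) :
    G.diotaE (r • f) e =ᵐ[volume.restrict (Ioo (G.a e.1) (G.b e.1))]
      fun x => r * G.diotaE f e x :=
  (weakDeriv_ae_eq_of_eqOn (memW12_iotaE (edgeDomain_smul hf r) e)
    ((G.isEdgeMeasure e).iota_smul (hf e) r).2).trans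
    ((memW12_iotaE hf e).hasDistribDeriv.const_mul r).weakDeriv_ae_eq

theorem integrable_diotaE_mul {f g : G.HE 𝕜} (hf : f ∈ G.edgeDomain 𝕜)
    (hg : g ∈ G.edgeDomain 𝕜) (e : G.E₁) :
    Integrable (fun x => G.diotaE f e x * (starRingEnd 𝕜) (G.diotaE g e x))
      (volume.restrict (Ioo (G.a e.1) (G.b e.1))) :=
  (memW12_iotaE hf e).memLp_weakDeriv.integrable_mul (memW12_iotaE hg e).memLp_weakDeriv.star

theorem hatH_ae_eq {f : G.HE 𝕜} (hf : f ∈ G.hatDomain) (e : G.E₁) :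
    G.hatH f e =ᵐ[G.μ e.1] fun x => - muDeriv (G.a e.1) (G.b e.1) (G.μ e.1) (G.diotaE f e) x := by
  have h := (hf e).2.2.2
  have e1 : G.hatH f e = - h.toLp _ := by
    simp only [hatH]
    rw [dif_pos h]
  rw [e1]
  filter_upwards [Lp.coeFn_neg (h.toLp _), h.coeFn_toLp] with x h1 h2
  rw [h1, Pi.neg_apply, h2]

theorem hatDomain_subset : (G.hatDomain : Set (G.HE 𝕜)) ⊆ G.edgeDomain 𝕜 := fun _ hf e => (hf e).1

end Edges

variable {G} [Finite V] [Finite E]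

theorem tr_add {f g : G.HΓ 𝕜} (hf : f.fst ∈ G.edgeDomain 𝕜) (hg : g.fst ∈ G.edgeDomain 𝕜) :
    G.tr (f + g) = G.tr f + G.tr g := by
  funext i
  rw [WSpace.add_apply]
  rcases i with ⟨e, j⟩ | v
  · have h := ((G.isEdgeMeasure e).iota_add (hf e) (hg e)).2
    by_cases hj : j = 0
    · simp only [tr, trace, if_pos hj]
      exact h (G.isEdgeMeasure e).left_mem_Icc
    · simp only [tr, trace, if_neg hj]
      exact h (G.isEdgeMeasure e).right_mem_Icc
  · rfl

theorem tr_smul {f : G.HΓ 𝕜} (hf : f.fst ∈ G.edgeDomain 𝕜) (r : 𝕜) :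
    G.tr (r • f) = r • G.tr f := by
  funext i
  rw [WSpace.smul_apply]
  rcases i with ⟨e, j⟩ | v
  · have h := ((G.isEdgeMeasure e).iota_smul (hf e) r).2
    by_cases hj : j = 0
    · simp only [tr, trace, if_pos hj]
      exact h (G.isEdgeMeasure e).left_mem_Icc
    · simp only [tr, trace, if_neg hj]
      exact h (G.isEdgeMeasure e).right_mem_Icc
  · rfl

/-! ### Linearity of the form in its first argument -/

section Form

variable (X : Submodule 𝕜 (G.TSpace 𝕜)) (L : X →ₗ[𝕜] X)

theorem add_mem_formDomain {f g : G.HΓ 𝕜} (hf : f ∈ G.formDomain X) (hg : g ∈ G.formDomain X) :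
    f + g ∈ G.formDomain X :=
  ⟨edgeDomain_add hf.1 hg.1, by rw [tr_add hf.1 hg.1]; exact X.add_mem hf.2 hg.2⟩

theorem smul_mem_formDomain {f : G.HΓ 𝕜} (hf : f ∈ G.formDomain X) (r : 𝕜) :
    r • f ∈ G.formDomain X :=
  ⟨edgeDomain_smul hf.1 r, by rw [tr_smul hf.1]; exact X.smul_mem r hf.2⟩

theorem form_add_left {f f' g : G.HΓ 𝕜} (hf : f ∈ G.formDomain X) (hf' : f' ∈ G.formDomain X)
    (hg : g ∈ G.formDomain X) : G.form X L (f + f') g = G.form X L f g + G.form X L f' g := by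
  have e : ∀ e : G.E₁, ∫ x in Ioo (G.a e.1) (G.b e.1),
      G.diotaE (f + f').fst e x * (starRingEnd 𝕜) (G.diotaE g.fst e x) =
      (∫ x in Ioo (G.a e.1) (G.b e.1), G.diotaE f.fst e x * (starRingEnd 𝕜) (G.diotaE g.fst e x)) +
      ∫ x in Ioo (G.a e.1) (G.b e.1),
        G.diotaE f'.fst e x * (starRingEnd 𝕜) (G.diotaE g.fst e x) := fun e => by
    rw [← integral_add (integrable_diotaE_mul hf.1 hg.1 e) (integrable_diotaE_mul hf'.1 hg.1 e)]
    refine integral_congr_ae ?_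
    filter_upwards [diotaE_add hf.1 hf'.1 e] with x hx
    rw [WithLp.add_fst, hx, add_mul]
  rw [form, tr_add hf.1 hf'.1, applyOn_add L hf.2 hf'.2, inner_add_right,
    Finset.sum_congr rfl fun i _ => e i, Finset.sum_add_distrib, form, form]
  ring

theorem form_smul_left {f g : G.HΓ 𝕜} (hf : f ∈ G.formDomain X) (r : 𝕜) :
    G.form X L (r • f) g = r * G.form X L f g := by
  have e : ∀ e : G.E₁, ∫ x in Ioo (G.a e.1) (G.b e.1),
      G.diotaE (r • f).fst e x * (starRingEnd 𝕜) (G.diotaE g.fst e x) =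
      r * ∫ x in Ioo (G.a e.1) (G.b e.1),
        G.diotaE f.fst e x * (starRingEnd 𝕜) (G.diotaE g.fst e x) := fun e => by
    rw [← integral_const_mul]
    refine integral_congr_ae ?_
    filter_upwards [diotaE_smul hf.1 r e] with x hx
    rw [WithLp.smul_fst, hx, mul_assoc]
  rw [form, tr_smul hf.1, applyOn_smul L r hf.2, inner_smul_right,
    Finset.sum_congr rfl fun i _ => e i, ← Finset.mul_sum, form]
  ring

end Form

/-! ### Green's formula and the weak equation -/

/-- Green's formula. -/
theorem sum_integral_diotaE {f : G.HΓ 𝕜} (hf : f.fst ∈ G.hatDomain) {g : G.HΓ 𝕜}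
    (hg : g.fst ∈ G.edgeDomain 𝕜) :
    ∑ e : G.E₁, ∫ x in Ioo (G.a e.1) (G.b e.1),
        G.diotaE f.fst e x * (starRingEnd 𝕜) (G.diotaE g.fst e x) =
      inner 𝕜 g.fst (G.hatH f.fst) - inner 𝕜 (G.tr g) (G.str f) := by
  rw [PiLp.inner_apply, WSpace.inner_eq, Fintype.sum_sum_type, Fintype.sum_prod_type,
    Finset.sum_eq_zero (s := (Finset.univ : Finset G.V₁)), add_zero, ← Finset.sum_sub_distrib]
  · refine Finset.sum_congr rfl fun e _ => ?_
    have hμ := G.isEdgeMeasure e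
    have := hμ.finite
    obtain ⟨g', hg'⟩ := (hf e).2.2.1
    have hd := hg'.muDeriv
    -- `strace` carries the derivative at `a` and minus the derivative at `b`, so the boundary terms
    -- are minus the pairing of the trace with the signed trace.
    refine (integral_mul_conj_weakDeriv (ν := G.μ e.1) hμ.lt hd.2 hd.1.integrableOn
      (memW12_iotaE hg e)).trans ?_
    rw [hμ.restrict_Ioo, L2.inner_def, Fin.sum_univ_two]
    have e1 : ∫ x, inner 𝕜 (g.fst e x) (G.hatH f.fst e x) ∂(G.μ e.1) =
        - ∫ x, muDeriv (G.a e.1) (G.b e.1) (G.μ e.1) (G.diotaE f.fst e) x *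
          (starRingEnd 𝕜) (G.iotaE g.fst e x) ∂(G.μ e.1) := by
      rw [← integral_neg]
      refine integral_congr_ae ?_
      filter_upwards [hatH_ae_eq hf e, (hμ.iota_spec (hg e)).2] with x h1 h2
      rw [h1, RCLike.inner_apply, ← h2, neg_mul]
      rfl
    rw [e1]
    simp only [str, strace, tr, trace, weight, if_true, if_neg (one_ne_zero : (1 : Fin 2) ≠ 0),
      RCLike.ofReal_one, mul_one]
    simp only [diotaE]
    ring
  · intro v _
    simp [str, strace]

/-- The vertex values of an element of `ℋ_Γ`, as an element of the space of boundary and vertex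
values. -/
def vertexPart (h : G.HΓ 𝕜) : G.TSpace 𝕜
  | Sum.inl _ => 0
  | Sum.inr v => h.snd v

/-- The trace of `g` contains the vertex values of `g` with the same weights, so the vertex terms
can be treated together with the boundary terms. -/
theorem inner_eq_add_vertexPart (g h : G.HΓ 𝕜) :
    inner 𝕜 g h = inner 𝕜 g.fst h.fst + inner 𝕜 (G.tr g) (vertexPart h) := by
  rw [WithLp.prod_inner_apply]
  congr 1
  rw [WSpace.inner_eq, WSpace.inner_eq, Fintype.sum_sum_type,
    Finset.sum_eq_zero (s := (Finset.univ : Finset (G.E₁ × Fin 2))), zero_add]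
  · rfl
  · intro i _
    simp [vertexPart]

theorem exists_tr_eq {X : Submodule 𝕜 (G.TSpace 𝕜)} {η : G.TSpace 𝕜} (hη : η ∈ X) :
    ∃ g ∈ G.formDomain X, G.tr g = η := by
  choose f hf ha hb using fun e : G.E₁ => (G.isEdgeMeasure e).exists_boundary_values
    (η (Sum.inl (e, 0))) (η (Sum.inl (e, 1)))
  let g : G.HΓ 𝕜 := WithLp.toLp 2 (WithLp.toLp 2 f, fun v => η (Sum.inr v))
  have hg : G.tr g = η := by
    funext i
    rcases i with ⟨e, j⟩ | v
    · fin_cases j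
      · exact ha e
      · exact hb e
    · rfl
  exact ⟨g, ⟨hf, hg.symm ▸ hη⟩, hg⟩

/-- An element supported on one edge with zero boundary values has trace zero, so it is admissible
whatever `X` is, and the form reduces to a single integral. -/
theorem hasMuDeriv_of_weak {X : Submodule 𝕜 (G.TSpace 𝕜)} {L : X →ₗ[𝕜] X} {f h : G.HΓ 𝕜}
    (hf : f ∈ G.formDomain X) (H : ∀ g ∈ G.formDomain X, G.form X L f g = inner 𝕜 g h)
    (e : G.E₁) : HasMuDeriv (G.a e.1) (G.b e.1) (G.μ e.1) (G.diotaE f.fst e)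
      (fun x => - h.fst e x) := by
  classical
  refine (G.isEdgeMeasure e).hasMuDeriv_of_forall_test (hf.1 e) fun g₀ hg₀ ha hb => ?_
  let q : ∀ e' : G.E₁, Lp 𝕜 2 (G.μ e'.1) := Function.update (fun _ => 0) e g₀
  let p : G.HE 𝕜 := WithLp.toLp 2 q
  let g : G.HΓ 𝕜 := WithLp.toLp 2 (p, 0)
  have hpe : p e = g₀ := by
    change q e = g₀
    simp only [q, Function.update_self]
  have hpn : ∀ e', e' ≠ e → p e' = 0 := fun e' he => by
    change q e' = 0
    simp only [q, Function.update_of_ne he]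
  have hdom : p ∈ G.edgeDomain 𝕜 := fun e' => by
    by_cases he : e' = e
    · subst he
      rw [hpe]
      exact hg₀
    · rw [hpn e' he]
      exact (G.isEdgeMeasure e').iota_zero.1
  have htr : G.tr g = 0 := by
    funext i
    rcases i with ⟨e', j⟩ | v
    · have hz : G.iotaE p e' (G.a e'.1) = 0 ∧ G.iotaE p e' (G.b e'.1) = 0 := by
        by_cases he : e' = e
        · subst he
          simp only [iotaE, hpe]
          exact ⟨ha, hb⟩
        · simp only [iotaE, hpn e' he]
          have h0 := ((G.isEdgeMeasure e').iota_zero (𝕜 := 𝕜)).2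
          exact ⟨h0 (G.isEdgeMeasure e').left_mem_Icc, h0 (G.isEdgeMeasure e').right_mem_Icc⟩
      change (if j = 0 then G.iotaE p e' (G.a e'.1) else G.iotaE p e' (G.b e'.1)) = 0
      rw [hz.1, hz.2, ite_self]
    · rfl
  have hgD : g ∈ G.formDomain X := ⟨hdom, by rw [htr]; exact X.zero_mem⟩
  have key := H g hgD
  rw [inner_eq_add_vertexPart, form, htr, inner_zero_left, inner_zero_left, add_zero, add_zero,
    PiLp.inner_apply, Finset.sum_eq_single e, Finset.sum_eq_single e] at key
  · change ∫ x in Ioo (G.a e.1) (G.b e.1), G.diotaE f.fst e x *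
      (starRingEnd 𝕜) (weakDeriv (G.a e.1) (G.b e.1)
        (iota (G.a e.1) (G.b e.1) (G.μ e.1) (p e)) x) = inner 𝕜 (p e) (h.fst e) at key
    rw [hpe] at key
    exact key
  · intro e' _ he
    change inner 𝕜 (p e') (h.fst e') = 0
    rw [hpn e' he, inner_zero_left]
  · exact fun h => absurd (Finset.mem_univ e) h
  · intro e' _ he
    -- The representative chosen for the zero class is only known to have derivative zero a.e.; this
    -- follows from homogeneity with factor 0.
    have hz : G.diotaE p e' =ᵐ[volume.restrict (Ioo (G.a e'.1) (G.b e'.1))] fun _ => 0 := by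
      have h1 : p e' = (0 : 𝕜) • p e' := by rw [hpn e' he, smul_zero]
      have h2 := diotaE_smul hdom (0 : 𝕜) e'
      have h3 : G.diotaE ((0 : 𝕜) • p) e' = G.diotaE p e' := by
        simp only [diotaE, iotaE]
        rw [PiLp.smul_apply, ← h1]
      rw [h3] at h2
      simpa only [zero_mul] using h2
    rw [← integral_zero ℝ 𝕜 (μ := volume.restrict (Ioo (G.a e'.1) (G.b e'.1)))]
    refine integral_congr_ae ?_
    filter_upwards [hz] with x hx
    change G.diotaE f.fst e' x * (starRingEnd 𝕜) (G.diotaE p e' x) = 0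
    rw [hx, map_zero, mul_zero]
  · exact fun h => absurd (Finset.mem_univ e) h

theorem mem_hatDomain_of_weak {X : Submodule 𝕜 (G.TSpace 𝕜)} {L : X →ₗ[𝕜] X} {f h : G.HΓ 𝕜}
    (hf : f ∈ G.formDomain X) (H : ∀ g ∈ G.formDomain X, G.form X L f g = inner 𝕜 g h) :
    f.fst ∈ G.hatDomain ∧ h.fst = G.hatH f.fst := by
  have hmu : ∀ e : G.E₁, muDeriv (G.a e.1) (G.b e.1) (G.μ e.1) (G.diotaE f.fst e) =ᵐ[G.μ e.1]
      fun x => - h.fst e x := fun e => by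
    have h1 := hasMuDeriv_of_weak hf H e
    have h2 := h1.muDeriv.2.unique h1.2
    rwa [(G.isEdgeMeasure e).restrict_Ioo] at h2
  have hD : f.fst ∈ G.hatDomain := fun e =>
    ⟨hf.1 e, (memW12_iotaE hf.1 e).integrableOn_weakDeriv, ⟨_, hasMuDeriv_of_weak hf H e⟩,
      (Lp.memLp (h.fst e)).neg.ae_eq (hmu e).symm⟩
  refine ⟨hD, PiLp.ext fun e => Lp.ext ?_⟩
  filter_upwards [hatH_ae_eq hD e, hmu e] with x h1 h2
  rw [h1, h2, neg_neg]

/-- The graph of the operator associated with the form. -/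
theorem weak_iff {X : Submodule 𝕜 (G.TSpace 𝕜)} {L : X →ₗ[𝕜] X} {f h : G.HΓ 𝕜} :
    (f ∈ G.formDomain X ∧ ∀ g ∈ G.formDomain X, G.form X L f g = inner 𝕜 g h) ↔
      f.fst ∈ G.hatDomain ∧ G.tr f ∈ X ∧ h.fst = G.hatH f.fst ∧
        ∀ η ∈ X, inner 𝕜 η (applyOn X L (G.tr f) - G.str f - vertexPart h) = 0 := by
  have key : f.fst ∈ G.hatDomain → h.fst = G.hatH f.fst → ∀ g ∈ G.formDomain X,
      (G.form X L f g = inner 𝕜 g h ↔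
        inner 𝕜 (G.tr g) (applyOn X L (G.tr f) - G.str f - vertexPart h) = 0) := by
    intro hf hh g hg
    rw [form, sum_integral_diotaE hf hg.1, inner_eq_add_vertexPart, hh, inner_sub_right,
      inner_sub_right]
    constructor
    · intro e
      linear_combination e
    · intro e
      linear_combination e
  constructor
  · rintro ⟨hf, H⟩
    obtain ⟨h1, h2⟩ := mem_hatDomain_of_weak hf H
    refine ⟨h1, hf.2, h2, fun η hη => ?_⟩
    obtain ⟨g, hg, rfl⟩ := exists_tr_eq hη
    exact (key h1 h2 g hg).1 (H g hg)
  · rintro ⟨h1, h2, h3, h4⟩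
    exact ⟨⟨hatDomain_subset h1, h2⟩, fun g hg => (key h1 h3 g hg).2 (h4 _ hg.2)⟩

end MGraph

theorem starProjection_eq_iff {𝕜 F : Type*} [RCLike 𝕜] [NormedAddCommGroup F] [InnerProductSpace 𝕜 F]
    (K : Submodule 𝕜 F) [K.HasOrthogonalProjection] (x y : F) :
    K.starProjection x = K.starProjection y ↔ ∀ η ∈ K, inner 𝕜 η (y - x) = 0 := by
  rw [eq_comm, ← sub_eq_zero, ← map_sub, Submodule.starProjection_apply_eq_zero_iff,
    Submodule.mem_orthogonal]

namespace MGraph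

variable {𝕜 : Type*} [RCLike 𝕜] {V E : Type*} {G : MGraph V E}

/-! ### Local boundary conditions -/

/-- Extension by zero of the values belonging to the vertex `v`. -/
def extendZero {v : V} (η : G.LSpace 𝕜 v) : G.TSpace 𝕜 := fun i =>
  open Classical in if h : G.vertexOf i = v then η ⟨i, h⟩ else 0

theorem restr_extendZero_self {v : V} (η : G.LSpace 𝕜 v) : G.restr v (extendZero η) = η := by
  funext i
  exact dif_pos i.2

theorem restr_extendZero_of_ne {v v' : V} (h : v' ≠ v) (η : G.LSpace 𝕜 v) :
    G.restr v' (extendZero η) = 0 := by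
  funext i
  exact dif_neg fun h' => h (i.2.symm.trans h')

theorem restr_applyOn {X : Submodule 𝕜 (G.TSpace 𝕜)} {L : X →ₗ[𝕜] X}
    {Xv : ∀ v : V, Submodule 𝕜 (G.LSpace 𝕜 v)} {Lv : ∀ v : V, Xv v →ₗ[𝕜] Xv v}
    (hloc : G.IsLocal X L Xv Lv) {ξ : G.TSpace 𝕜} (hξ : ξ ∈ X) (v : V) :
    G.restr v (applyOn X L ξ) = applyOn (Xv v) (Lv v) (G.restr v ξ) := by
  obtain ⟨h1, h2⟩ := hloc.op_eq ⟨ξ, hξ⟩ v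
  rw [applyOn_of_mem L hξ, h2, applyOn_of_mem (Lv v) h1]

theorem sub_smul_mem_localZero {v : V} {Xv : Submodule 𝕜 (G.LSpace 𝕜 v)} (hv : 0 < G.m v)
    {η ξ : G.LSpace 𝕜 v} (hη : η ∈ Xv) (hξ : ξ ∈ Xv) (h1 : ξ (G.vIdx hv) = 1) :
    η - η (G.vIdx hv) • ξ ∈ G.localZero Xv := by
  refine ⟨Xv.sub_mem hη (Xv.smul_mem _ hξ), fun hv' => ?_⟩
  change η (G.vIdx hv) - η (G.vIdx hv) * ξ (G.vIdx hv) = 0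
  rw [h1, mul_one, sub_self]

variable [Finite V] [Finite E]

theorem inner_eq_sum_restr [Fintype V] (x y : G.TSpace 𝕜) :
    inner 𝕜 x y = ∑ v : V, inner 𝕜 (G.restr v x) (G.restr v y) := by
  classical
  have h := Fintype.sum_fiberwise G.vertexOf
    fun i => y i * (starRingEnd 𝕜) (x i) * ((G.weight i : ℝ) : 𝕜)
  refine h.symm.trans (Finset.sum_congr rfl fun v _ => ?_)
  let e : {i : G.Idx // G.vertexOf i = v} ≃ G.LIdx v := Equiv.refl _
  refine Eq.trans ?_ (WSpace.inner_eq (ι := G.LIdx v) _ _ _).symm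
  exact Fintype.sum_equiv e _ _ fun _ => rfl

/-- The scalar product is the sum of its vertex contributions, and the extension by zero of an
element of `Xv v` lies in `X`. -/
theorem inner_eq_zero_iff_local {X : Submodule 𝕜 (G.TSpace 𝕜)} {L : X →ₗ[𝕜] X}
    {Xv : ∀ v : V, Submodule 𝕜 (G.LSpace 𝕜 v)} {Lv : ∀ v : V, Xv v →ₗ[𝕜] Xv v}
    (hloc : G.IsLocal X L Xv Lv) (y : G.TSpace 𝕜) :
    (∀ η ∈ X, inner 𝕜 η y = 0) ↔ ∀ v, ∀ η ∈ Xv v, inner 𝕜 η (G.restr v y) = 0 := by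
  classical
  have := Fintype.ofFinite V
  constructor
  · intro h v η hη
    have hX : extendZero η ∈ X := (hloc.mem_iff _).2 fun v' => by
      by_cases hv : v' = v
      · subst hv
        rwa [restr_extendZero_self]
      · rw [restr_extendZero_of_ne hv]
        exact zero_mem _
    have h1 := h _ hX
    rwa [inner_eq_sum_restr, Finset.sum_eq_single v
      (fun v' _ hv => by rw [restr_extendZero_of_ne hv, inner_zero_left])
      (fun hv => absurd (Finset.mem_univ v) hv), restr_extendZero_self] at h1
  · intro h η hη
    rw [inner_eq_sum_restr]
    exact Finset.sum_eq_zero fun v _ => h v _ ((hloc.mem_iff η).1 hη v)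

theorem inner_vertexPart_of_massive {v : V} (hv : 0 < G.m v) (η : G.LSpace 𝕜 v) (h : G.HΓ 𝕜) :
    inner 𝕜 η (G.restr v (vertexPart h)) =
      h.snd ⟨v, hv⟩ * (starRingEnd 𝕜) (η (G.vIdx hv)) * (G.m v : 𝕜) := by
  rw [WSpace.inner_eq, Finset.sum_eq_single (G.vIdx hv)]
  · rfl
  · rintro ⟨i | v', hi⟩ _ hne
    · simp [restr, vertexPart]
    · refine absurd ?_ hne
      change v'.1 = v at hi
      subst hi
      rfl
  · exact fun h => absurd (Finset.mem_univ _) h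

theorem inner_vertexPart_of_massless {v : V} (hv : ¬ 0 < G.m v) (η : G.LSpace 𝕜 v)
    (h : G.HΓ 𝕜) : inner 𝕜 η (G.restr v (vertexPart h)) = 0 := by
  rw [WSpace.inner_eq]
  refine Finset.sum_eq_zero ?_
  rintro ⟨i | v', hi⟩ _
  · simp [restr, vertexPart]
  · change v'.1 = v at hi
    exact absurd (hi ▸ v'.2) hv

theorem inner_vertexPart_of_mem_localZero {v : V} {Xv : Submodule 𝕜 (G.LSpace 𝕜 v)}
    {η : G.LSpace 𝕜 v} (hη : η ∈ G.localZero Xv) (h : G.HΓ 𝕜) :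
    inner 𝕜 η (G.restr v (vertexPart h)) = 0 := by
  by_cases hv : 0 < G.m v
  · rw [inner_vertexPart_of_massive hv, hη.2 hv, map_zero, mul_zero, zero_mul]
  · exact inner_vertexPart_of_massless hv η h

/-- The condition at a single vertex, split into the boundary condition and the formula for the
value at the vertex. -/
theorem local_condition_iff {v : V} {Xv : Submodule 𝕜 (G.LSpace 𝕜 v)}
    (hX : ∀ hv : 0 < G.m v, ∃ ξ ∈ Xv, ξ (G.vIdx hv) = 1) (y : G.LSpace 𝕜 v) (h : G.HΓ 𝕜) :
    (∀ η ∈ Xv, inner 𝕜 η (y - G.restr v (vertexPart h)) = 0) ↔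
      (∀ η ∈ G.localZero Xv, inner 𝕜 η y = 0) ∧
        ∀ hv : 0 < G.m v, ∀ ξ ∈ Xv, ξ (G.vIdx hv) = 1 →
          h.snd ⟨v, hv⟩ = ((G.m v : ℝ) : 𝕜)⁻¹ * inner 𝕜 ξ y := by
  constructor
  · intro H
    refine ⟨fun η hη => ?_, fun hv ξ hξ h1 => ?_⟩
    · have h2 := H η hη.1
      rwa [inner_sub_right, inner_vertexPart_of_mem_localZero hη, sub_zero] at h2
    · have h2 := H ξ hξ
      have hm : ((G.m v : ℝ) : 𝕜) ≠ 0 := RCLike.ofReal_ne_zero.2 hv.ne'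
      rw [inner_sub_right, inner_vertexPart_of_massive hv, h1, map_one, mul_one, sub_eq_zero] at h2
      rw [h2, mul_comm, mul_inv_cancel_right₀ hm]
  · rintro ⟨H0, H1⟩ η hη
    rw [inner_sub_right]
    by_cases hv : 0 < G.m v
    · obtain ⟨ξ, hξ, h1⟩ := hX hv
      have hm : ((G.m v : ℝ) : 𝕜) ≠ 0 := RCLike.ofReal_ne_zero.2 hv.ne'
      -- Since `η` differs from a multiple of `ξ` by an element of X_{v,0}, testing with `ξ`
      -- suffices.
      have h2 := H0 _ (sub_smul_mem_localZero hv hη hξ h1)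
      rw [inner_sub_left, inner_smul_left, sub_eq_zero] at h2
      rw [inner_vertexPart_of_massive hv, H1 hv ξ hξ h1, h2]
      field_simp
      ring
    · rw [inner_vertexPart_of_massless hv, sub_zero]
      refine H0 η ⟨hη, fun hv' => absurd hv' hv⟩

end MGraph

end QGraph

end

/-! ### The operator associated with the form -/

theorem corollary5p1 {𝕜 : Type*} [RCLike 𝕜] {V E : Type*} [Finite V] [Finite E]
    (G : QGraph.MGraph V E)
    -- the subspace `X` and the self-adjoint operator `L` in `X` that determine the form
    (X : Submodule 𝕜 (G.TSpace 𝕜)) (L : X →ₗ[𝕜] X) (hL : L.IsSymmetric)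
    -- the condition for the domain of the form to be dense
    (hdense : ∀ z : G.V₁ → 𝕜, ∃ ξ ∈ X, ∀ v : G.V₁, ξ (Sum.inr v) = z v)
    -- the boundary conditions are local
    (Xv : ∀ v : V, Submodule 𝕜 (G.LSpace 𝕜 v)) (Lv : ∀ v : V, Xv v →ₗ[𝕜] Xv v)
    (hLv : ∀ v : V, (Lv v).IsSymmetric) (hloc : G.IsLocal X L Xv Lv) :
    ∃ H : G.HΓ 𝕜 →ₗ.[𝕜] G.HΓ 𝕜, G.IsAssociated X L H ∧
      (∀ f : G.HΓ 𝕜, f ∈ H.domain ↔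
        f.fst ∈ G.hatDomain ∧
        ∀ v : V, G.restr v (G.tr f) ∈ Xv v ∧
          (G.localZero (Xv v)).starProjection (G.restr v (G.str f)) =
            (G.localZero (Xv v)).starProjection (QGraph.applyOn (Xv v) (Lv v) (G.restr v (G.tr f)))) ∧
      (∀ f : H.domain,
        (H f).fst = G.hatH (f : G.HΓ 𝕜).fst ∧
        ∀ v : G.V₁, ∀ ξ ∈ Xv v.1, ξ (G.vIdx v.2) = 1 →
          (H f).snd v = ((G.m v.1 : ℝ) : 𝕜)⁻¹ *
            inner 𝕜 ξ (QGraph.applyOn (Xv v.1) (Lv v.1) (G.restr v.1 (G.tr (f : G.HΓ 𝕜)))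
              - G.restr v.1 (G.str (f : G.HΓ 𝕜)))) := by
  classical
  have hX : ∀ v : V, ∀ hv : 0 < G.m v, ∃ ξ ∈ Xv v, ξ (G.vIdx hv) = 1 := fun v hv => by
    obtain ⟨ξ, hξ, h1⟩ := hdense fun _ => 1
    exact ⟨G.restr v ξ, (hloc.mem_iff ξ).1 hξ v, h1 ⟨v, hv⟩⟩
  -- the characterization of the graph by local conditions
  have key : ∀ f h : G.HΓ 𝕜,
      (f ∈ G.formDomain X ∧ ∀ g ∈ G.formDomain X, G.form X L f g = inner 𝕜 g h) ↔
      f.fst ∈ G.hatDomain ∧ h.fst = G.hatH f.fst ∧ ∀ v : V, (G.restr v (G.tr f) ∈ Xv v ∧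
        (G.localZero (Xv v)).starProjection (G.restr v (G.str f)) =
          (G.localZero (Xv v)).starProjection
            (QGraph.applyOn (Xv v) (Lv v) (G.restr v (G.tr f)))) ∧
        ∀ hv : 0 < G.m v, ∀ ξ ∈ Xv v, ξ (G.vIdx hv) = 1 →
          h.snd ⟨v, hv⟩ = ((G.m v : ℝ) : 𝕜)⁻¹ *
            inner 𝕜 ξ (QGraph.applyOn (Xv v) (Lv v) (G.restr v (G.tr f))
              - G.restr v (G.str f)) := fun f h => by
    rw [QGraph.MGraph.weak_iff, QGraph.MGraph.inner_eq_zero_iff_local hloc]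
    have hres : G.tr f ∈ X → ∀ v, G.restr v (QGraph.applyOn X L (G.tr f) - G.str f -
        QGraph.MGraph.vertexPart h) = QGraph.applyOn (Xv v) (Lv v) (G.restr v (G.tr f))
          - G.restr v (G.str f) - G.restr v (QGraph.MGraph.vertexPart h) := fun hf v => by
      rw [← QGraph.MGraph.restr_applyOn hloc hf v]
      rfl
    constructor
    · rintro ⟨h1, h2, h3, h4⟩
      refine ⟨h1, h3, fun v => ?_⟩
      have h5 := h4 v
      rw [hres h2, QGraph.MGraph.local_condition_iff (hX v),
        ← QGraph.starProjection_eq_iff] at h5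
      exact ⟨⟨(hloc.mem_iff _).1 h2 v, h5.1⟩, h5.2⟩
    · rintro ⟨h1, h3, h4⟩
      have h2 : G.tr f ∈ X := (hloc.mem_iff _).2 fun v => (h4 v).1.1
      refine ⟨h1, h2, h3, fun v => ?_⟩
      rw [hres h2, QGraph.MGraph.local_condition_iff (hX v),
        ← QGraph.starProjection_eq_iff]
      exact ⟨(h4 v).1.2, (h4 v).2⟩
  -- the graph of the operator
  let R : Submodule 𝕜 (G.HΓ 𝕜 × G.HΓ 𝕜) :=
    { carrier := {p | p.1 ∈ G.formDomain X ∧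
        ∀ g ∈ G.formDomain X, G.form X L p.1 g = inner 𝕜 g p.2}
      add_mem' := fun {p q} hp hq => ⟨QGraph.MGraph.add_mem_formDomain X hp.1 hq.1,
        fun g hg => by
          rw [Prod.fst_add, Prod.snd_add, QGraph.MGraph.form_add_left X L hp.1 hq.1 hg,
            hp.2 g hg, hq.2 g hg, inner_add_right]⟩
      zero_mem' := by
        obtain ⟨g, hg, -⟩ := QGraph.MGraph.exists_tr_eq X.zero_mem
        have h0 := QGraph.MGraph.smul_mem_formDomain X hg (0 : 𝕜)
        rw [zero_smul] at h0
        refine ⟨h0, fun g' _ => ?_⟩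
        have h1 := QGraph.MGraph.form_smul_left X L (g := g') hg (0 : 𝕜)
        rw [zero_smul, zero_mul] at h1
        rw [Prod.fst_zero, Prod.snd_zero, inner_zero_right, h1]
      smul_mem' := fun r p hp => ⟨QGraph.MGraph.smul_mem_formDomain X hp.1 r,
        fun g hg => by
          rw [Prod.smul_fst, Prod.smul_snd, QGraph.MGraph.form_smul_left X L hp.1,
            hp.2 g hg, inner_smul_right]⟩ }
  have hR : ∀ f h : G.HΓ 𝕜, (f, h) ∈ R ↔
      f ∈ G.formDomain X ∧ ∀ g ∈ G.formDomain X, G.form X L f g = inner 𝕜 g h := fun _ _ => Iff.rfl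
  -- Single-valuedness: Ĥ fixes the edge components, and the existence of some `ξ` with value 1 at
  -- each vertex with mass fixes the vertex components.
  have huniq : ∀ f h h' : G.HΓ 𝕜, (f, h) ∈ R → (f, h') ∈ R → h = h' := fun f h h' e e' => by
    obtain ⟨-, e1, e2⟩ := (key f h).1 e
    obtain ⟨-, e1', e2'⟩ := (key f h').1 e'
    have hs : h.snd = h'.snd := funext fun v => by
      obtain ⟨ξ, hξ, h1⟩ := hX v.1 v.2
      exact ((e2 v.1).2 v.2 ξ hξ h1).trans ((e2' v.1).2 v.2 ξ hξ h1).symm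
    exact WithLp.ofLp_injective 2 (Prod.ext (e1.trans e1'.symm) hs)
  have hgraph : R.toLinearPMap.graph = R := Submodule.toLinearPMap_graph_eq R fun p hp h0 => by
    obtain ⟨f, h⟩ := p
    exact huniq f h 0 hp (by rw [show f = 0 from h0]; exact R.zero_mem)
  have happ : ∀ f : R.toLinearPMap.domain, ((f : G.HΓ 𝕜), R.toLinearPMap f) ∈ R := fun f => by
    have h := R.toLinearPMap.mem_graph f
    rwa [hgraph] at h
  refine ⟨R.toLinearPMap, fun f h => by rw [hgraph]; exact hR f h, fun f => ?_, fun f => ?_⟩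
  · constructor
    · intro hf
      obtain ⟨h1, -, h2⟩ := (key _ _).1 (happ ⟨f, hf⟩)
      exact ⟨h1, fun v => (h2 v).1⟩
    · rintro ⟨h1, h2⟩
      choose ξ hξ h3 using hX
      let z : QGraph.WSpace 𝕜 G.vWeight := fun v => ((G.m v.1 : ℝ) : 𝕜)⁻¹ *
        inner 𝕜 (ξ v.1 v.2) (QGraph.applyOn (Xv v.1) (Lv v.1) (G.restr v.1 (G.tr f))
          - G.restr v.1 (G.str f))
      have hmem : (f, (WithLp.toLp 2 (G.hatH f.fst, z) : G.HΓ 𝕜)) ∈ R := by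
        rw [hR, key]
        refine ⟨h1, rfl, fun v => ⟨h2 v, fun hv ξ' hξ' h4 => ?_⟩⟩
        change ((G.m v : ℝ) : 𝕜)⁻¹ * inner 𝕜 (ξ v hv) _ = _
        -- The vertex value does not depend on the choice of `ξ`: two choices differ by an element
        -- of X_{v,0}, to which the boundary condition makes the vector orthogonal.
        have h5 := (QGraph.starProjection_eq_iff _ _ _).1 (h2 v).2 _
          (QGraph.MGraph.sub_smul_mem_localZero hv (hξ v hv) hξ' h4)
        rw [h3, one_smul, inner_sub_left, sub_eq_zero] at h5
        rw [h5]
      rw [← hgraph] at hmem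
      exact LinearPMap.mem_domain_of_mem_graph hmem
  · obtain ⟨-, h1, h2⟩ := (key _ _).1 (happ f)
    exact ⟨h1, fun v => (h2 v.1).2 v.2⟩
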